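/- Let $M$ be a smooth manifold (Hausdorff, second countable, without boundary) of dimension $n$. Write $A^k(M)=\Gamma(\wedge^kTM)$ (with $A^{0}(M)=C^\infty(M)$, and $A^k(M)=0$ for $k<0$), $\mathcal A(M)=\bigoplus_k A^k(M)$, and let $[\cdot,\cdot]$ be the Schouten–Nijenhuis bracket on $\mathcal A(M)$: the $\mathbb R$-bilinear bracket $A^k(M)\times A^l(M)\to A^{k+l-1}(M)$ with $[f,g]=0$ for functions, $[X,Q]=L_XQ$ for vector fields $X$, $[P,Q]=-(-1)^{(p-1)(q-1)}[Q,P]$, and $[P,Q\wedge R]=[P,Q]\wedge R+(-1)^{(p-1)q}Q\wedge[P,R]$ for $P\in A^p(M)$, $Q\in A^q(M)$, $R\in\mathcal A(M)$. A *higher connection* on $M$ is a map $\nabla:\mathcal A(M)\times\mathcal A(M)\to\mathcal A(M)$ such that, for $f\in C^\infty(M)$ and multivector fields $X,X',Y,Y'$: (i) $\nabla_XY\in A^{k+l-1}(M)$ if $X\in A^k(M)$, $Y\in A^l(M)$; (ii) $\nabla_{fX+X'}Y=f\nabla_XY+\nabla_{X'}Y$; (iii) $\nabla_X(Y+Y')=\nabla_XY+\nabla_XY'$;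 (iv) $\nabla_Xf=[X,f]$ for $X\in A^k(M)$; (v) $\nabla_X(fY)=[X,f]\wedge Y+f\nabla_XY$ for $X\in A^k(M)$; (vi) $\nabla_fX=0$. Its *higher torsion* is $T(X,Y)=\nabla_XY-(-1)^{(k-1)(l-1)}\nabla_YX-[X,Y]$ for $X\in A^k(M)$, $Y\in A^l(M)$. It is *almost torsion-free* if $T(X,Y)=0$ for all $X,Y\in A^1(M)$, and $T(X,Y)=0$ for all homogeneous $X,Y$ with $X\wedge Y=0$. For forms put $(i_X\omega)(Y)=\omega(X\wedge Y)$ and, for $X\in A^k(M)$, $L_X\omega=d\,i_X\omega-(-1)^k i_X\,d\omega$. For $X\in A^k(M)$ with $k>0$, $\omega\in\Omega^l(M)$ with $l-k+1\ge0$, and $Y\in A^{l-k+1}(M)$, put $$(\nabla_X\omega)(Y)=(-1)^{(k-1)(l-1)}L_Xi_Y\omega-\omega(\nabla_XY).$$ An *associative bilinear form* $\eta$ on $M$ is a smooth fibrewise $\mathbb R$-bilinear form on $\wedge^\bullet TM$ with $\eta(x\wedge y,z)=\eta(x,y\wedge z)$. Its components are the forms $\omega^{(t)}\in\Omega^t(M)$,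 $\omega^{(t)}(x)=\eta(x,1)$ for $x\in\wedge^tT_pM$. One writes $\nabla\eta\equiv0$ if $(\nabla_X\omega^{(k+l+m-1)})(Y\wedge Z)=0$ for all $X\in A^k(M)$, $Y\in A^l(M)$, $Z\in A^m(M)$ with $k>0$ and $l+m>0$. **Theorem.** Let $\eta$ be an associative bilinear form on $M$ with $\omega^{(1)}\equiv0$. 1. If, for every $t>1$ with $\omega^{(t)}\not\equiv0$, the form $\omega^{(t)}$ is nowhere vanishing ($\omega^{(t)}_p\ne0$ for all $p\in M$), then $M$ admits an almost torsion-free higher connection $\nabla$ with $\nabla\eta\equiv0$. 2. In particular, this holds if, for every $t>1$ with $\omega^{(t)}\not\equiv0$, the form $\omega^{(t)}$ is multisymplectic, i.e. $d\omega^{(t)}=0$ and, for all $p\in M$ and $v\in T_pM$, $i_v\omega^{(t)}=0$ if and only if $v=0$. -/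

import Mathlib

open scoped Manifold ContDiff Topology

noncomputable section

namespace HigherConn

/-! ## Multilinear algebra and calculus on the model space `ℝⁿ` -/

/-- The model space `ℝⁿ`. -/
abbrev Model (n : ℕ) : Type := EuclideanSpace ℝ (Fin n)

/-- The standard basis `e₁, …, eₙ` of `ℝⁿ`. -/
def stdBasis (n : ℕ) : Module.Basis (Fin n) ℝ (Model n) :=
  (EuclideanSpace.basisFun (Fin n) ℝ).toBasis

/-- The basis `e_S = e_{i₁} ∧ ⋯ ∧ e_{iₖ}`, `S = {i₁ < ⋯ < iₖ}`, of `∧^• ℝⁿ`. -/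
def extBasis (n : ℕ) : Module.Basis (Finset (Fin n)) ℝ (ExteriorAlgebra ℝ (Model n)) :=
  (stdBasis n).ExteriorAlgebra

/-- The componentwise partial derivative `∂P/∂xⁱ` at `y` of a multivector valued function on
`ℝⁿ`. -/
def partialMV {n : ℕ} (P : Model n → ExteriorAlgebra ℝ (Model n)) (i : Fin n) (y : Model n) :
    ExteriorAlgebra ℝ (Model n) :=
  ∑ S : Finset (Fin n),
    fderiv ℝ (fun z => (extBasis n).repr (P z) S) y (stdBasis n i) • extBasis n S

/-- The contraction `dxⁱ ⌟ x` of a multivector with `dxⁱ` (in the first slot); it is the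
antiderivation of `∧^• ℝⁿ` with `dxⁱ ⌟ v = vⁱ` on vectors. -/
def contr {n : ℕ} (i : Fin n) (x : ExteriorAlgebra ℝ (Model n)) : ExteriorAlgebra ℝ (Model n) :=
  CliffordAlgebra.contractLeft (Q := (0 : QuadraticForm ℝ (Model n))) ((stdBasis n).coord i) x

/-- The Schouten–Nijenhuis bracket of multivector fields on `ℝⁿ`: for `P` of degree `k`,
`[P, Q] = ∑ᵢ ((-1)^(k-1) (dxⁱ ⌟ P) ∧ ∂ᵢQ - ∂ᵢP ∧ (dxⁱ ⌟ Q))`.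
The grade involution produces the sign `(-1)^(k-1)`, as `dxⁱ ⌟ P` has degree `k - 1`. -/
def schoutenLocal {n : ℕ} (P Q : Model n → ExteriorAlgebra ℝ (Model n)) (y : Model n) :
    ExteriorAlgebra ℝ (Model n) :=
  ∑ i : Fin n,
    (CliffordAlgebra.involute (Q := (0 : QuadraticForm ℝ (Model n))) (contr i (P y))
        * partialMV Q i y
      - partialMV P i y * contr i (Q y))

/-- Alternating maps on `ℝⁿ` are continuous. -/
theorem continuous_alternating {n k : ℕ} (f : Model n [⋀^Fin k]→ₗ[ℝ] ℝ) : Continuous f := by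
  have h : ∀ v : Fin k → Model n,
      f v = ∑ r : Fin k → Fin n, (∏ i, (v i) (r i)) • f (fun i => stdBasis n (r i)) := by
    intro v
    have hv : v = fun i => ∑ j, (v i) j • stdBasis n j := by
      funext i
      have := (stdBasis n).sum_repr (v i)
      simpa [stdBasis] using this.symm
    have h1 : f v = f.toMultilinearMap (fun i => ∑ j, (v i) j • stdBasis n j) := by
      rw [← hv]; rfl
    rw [h1, MultilinearMap.map_sum]
    refine Finset.sum_congr rfl fun r _ => ?_
    exact f.toMultilinearMap.map_smul_univ _ _
  have h' : (f : (Fin k → Model n) → ℝ) =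
      fun v => ∑ r : Fin k → Fin n, (∏ i, (v i) (r i)) • f (fun i => stdBasis n (r i)) :=
    funext h
  rw [h']
  fun_prop

/-- The degree `k` part of a covector `α ∈ (∧^• ℝⁿ)*`, as an alternating form
`(v₁, …, vₖ) ↦ α (v₁ ∧ ⋯ ∧ vₖ)`. -/
def altPart {n : ℕ} (k : ℕ) (α : Module.Dual ℝ (ExteriorAlgebra ℝ (Model n))) :
    Model n [⋀^Fin k]→L[ℝ] ℝ :=
  { α.compAlternatingMap (ExteriorAlgebra.ιMulti ℝ k) with
    cont := continuous_alternating (α.compAlternatingMap (ExteriorAlgebra.ιMulti ℝ k)) }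

/-- The exterior derivative on `ℝⁿ` of an inhomogeneous form `α : ℝⁿ → (∧^• ℝⁿ)*`, degree by
degree. -/
def extDerivLocal {n : ℕ} (α : Model n → Module.Dual ℝ (ExteriorAlgebra ℝ (Model n)))
    (y : Model n) : Module.Dual ℝ (ExteriorAlgebra ℝ (Model n)) :=
  ExteriorAlgebra.liftAlternating fun k =>
    match k with
    | 0 => 0
    | k + 1 => (extDeriv (fun z => altPart k (α z)) y).toAlternatingMap

/-! ## Multivector fields and differential forms on a manifold -/

section Manifold

variable {n : ℕ} {M : Type*} [TopologicalSpace M] [ChartedSpace (Model n) M]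

/-- The fibre `∧^• T_pM` of the full exterior bundle. -/
abbrev ExtFibre (n : ℕ) {M : Type*} [TopologicalSpace M] [ChartedSpace (Model n) M]
    (p : M) : Type :=
  ExteriorAlgebra ℝ (TangentSpace (𝓡 n) p)

/-- The (not necessarily smooth) sections of the full exterior bundle `∧^• TM`. -/
abbrev RoughMVF (n : ℕ) (M : Type*) [TopologicalSpace M] [ChartedSpace (Model n) M] : Type _ :=
  (p : M) → ExtFibre n p

/-- The (not necessarily smooth) inhomogeneous differential forms, as sections of
`(∧^• TM)* ≅ ∧^• T*M`. -/
abbrev RoughForm (n : ℕ) (M : Type*) [TopologicalSpace M] [ChartedSpace (Model n) M] : Type _ :=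
  (p : M) → Module.Dual ℝ (ExtFibre n p)

/-- The differential at `q` of the chart around `p`. -/
def chartDiff (p q : M) : TangentSpace (𝓡 n) q →L[ℝ] Model n :=
  mfderiv (𝓡 n) 𝓘(ℝ, Model n) (extChartAt (𝓡 n) p) q

/-- The differential at `q` of the chart around `p`, extended to `∧^• T_qM → ∧^• ℝⁿ`. -/
def chartExt (p q : M) : ExtFibre n q →ₐ[ℝ] ExteriorAlgebra ℝ (Model n) :=
  ExteriorAlgebra.map (chartDiff p q).toLinearMap

/-- The inverse of the differential at `q` of the chart around `p`, extended to
`∧^• ℝⁿ → ∧^• T_qM`. -/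
def chartExtInv (p q : M) : ExteriorAlgebra ℝ (Model n) →ₐ[ℝ] ExtFibre n q :=
  ExteriorAlgebra.map (chartDiff p q).inverse.toLinearMap

/-- A section of `∧^• TM`, read in the chart around `p`. -/
def coordMVF (X : RoughMVF n M) (p : M) (y : Model n) : ExteriorAlgebra ℝ (Model n) :=
  chartExt p ((extChartAt (𝓡 n) p).symm y) (X ((extChartAt (𝓡 n) p).symm y))

/-- A differential form, read in the chart around `p`. -/
def coordForm (α : RoughForm n M) (p : M) (y : Model n) :
    Module.Dual ℝ (ExteriorAlgebra ℝ (Model n)) :=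
  α ((extChartAt (𝓡 n) p).symm y) ∘ₗ
    (chartExtInv p ((extChartAt (𝓡 n) p).symm y)).toLinearMap

/-- A section of `∧^• TM` is smooth if its coefficients in the charts are. -/
def IsSmoothMVF (X : RoughMVF n M) : Prop :=
  ∀ (p : M) (S : Finset (Fin n)),
    ContDiffOn ℝ ∞ (fun y => (extBasis n).repr (coordMVF X p y) S) (extChartAt (𝓡 n) p).target

/-- The Schouten–Nijenhuis bracket at `p`, computed in the chart around `p`. -/
def schouten (X Y : RoughMVF n M) : RoughMVF n M := fun p =>
  chartExtInv p p (schoutenLocal (coordMVF X p) (coordMVF Y p) (extChartAt (𝓡 n) p p))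

/-- The exterior derivative at `p`, computed in the chart around `p`. -/
def extDerivForm (α : RoughForm n M) : RoughForm n M := fun p =>
  extDerivLocal (coordForm α p) (extChartAt (𝓡 n) p p) ∘ₗ
    (chartExt p p).toLinearMap

/-- The interior product, `(i_X α)(Y) = α(X ∧ Y)`. -/
def interior (X : RoughMVF n M) (α : RoughForm n M) : RoughForm n M := fun p =>
  α p ∘ₗ LinearMap.mulLeft ℝ (X p)

/-- The Lie derivative `L_X α = d i_X α - (-1)^k i_X dα` along a multivector field of degree
`k`. -/
def lieDerivForm (k : ℕ) (X : RoughMVF n M) (α : RoughForm n M) : RoughForm n M := fun p =>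
  extDerivForm (interior X α) p - (-1 : ℝ) ^ k • interior X (extDerivForm α) p

theorem mul_repr_smooth {s : Set (Model n)} {P Q : Model n → ExteriorAlgebra ℝ (Model n)}
    (hP : ∀ S, ContDiffOn ℝ ∞ (fun y => (extBasis n).repr (P y) S) s)
    (hQ : ∀ S, ContDiffOn ℝ ∞ (fun y => (extBasis n).repr (Q y) S) s) (S : Finset (Fin n)) :
    ContDiffOn ℝ ∞ (fun y => (extBasis n).repr (P y * Q y) S) s := by
  have h : ∀ y, (extBasis n).repr (P y * Q y) S =
      ∑ A, ∑ B, (extBasis n).repr (P y) A * ((extBasis n).repr (Q y) B *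
        (extBasis n).repr (extBasis n A * extBasis n B) S) := by
    intro y
    conv_lhs => rw [← (extBasis n).sum_repr (P y), ← (extBasis n).sum_repr (Q y)]
    simp only [Finset.sum_mul, Finset.mul_sum, map_sum, Finsupp.finsetSum_apply, smul_mul_assoc,
      mul_smul_comm, map_smul, Finsupp.smul_apply, smul_eq_mul]
    rw [Finset.sum_comm]
    refine Finset.sum_congr rfl fun A _ => Finset.sum_congr rfl fun B _ => ?_
    ring
  simp only [h]
  exact ContDiffOn.sum fun A _ => ContDiffOn.sum fun B _ =>
    (hP A).mul ((hQ B).mul contDiffOn_const)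

variable (n M) in
/-- The algebra `𝒜(M) = ⨁ₖ A^k(M)` of multivector fields, i.e. of smooth sections of `∧^• TM`,
under the (pointwise) exterior product. -/
def mvfAlgebra : Subalgebra ℝ (RoughMVF n M) where
  carrier := {X | IsSmoothMVF X}
  add_mem' {X Y} hX hY p S := by
    refine ((hX p S).add (hY p S)).congr fun y _ => ?_
    simp only [coordMVF, Pi.add_apply, map_add, Finsupp.add_apply]
  mul_mem' {X Y} hX hY p S := by
    refine (mul_repr_smooth (hX p) (hY p) S).congr fun y _ => ?_
    simp only [coordMVF, Pi.mul_apply, map_mul]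
  algebraMap_mem' r p S := by
    refine (contDiffOn_const
      (c := (extBasis n).repr (algebraMap ℝ (ExteriorAlgebra ℝ (Model n)) r) S)).congr
        fun y _ => ?_
    simp only [coordMVF, Pi.algebraMap_apply, AlgHom.commutes]

variable (n M) in
/-- The multivector fields on `M`. -/
abbrev MVF : Type _ := mvfAlgebra n M

/-- `X ∈ A^k(M)`: the multivector field `X` is homogeneous of degree `k`. -/
def MVF.HasDegree (k : ℕ) (X : MVF n M) : Prop :=
  ∀ p : M, X.1 p ∈ ⋀[ℝ]^k (TangentSpace (𝓡 n) p)

/-- A smooth function, as an element of `A^0(M) = C^∞(M)`. The product `f X` of a function and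
a multivector field is then the product `ofFun f * X` in `𝒜(M)`. -/
def ofFun [IsManifold (𝓡 n) ∞ M] (f : C^∞⟮𝓡 n, M; ℝ⟯) : MVF n M :=
  ⟨fun p => algebraMap ℝ (ExtFibre n p) (f p), fun p S => by
    have hf : ContDiffOn ℝ ∞ (fun y => f ((extChartAt (𝓡 n) p).symm y))
        (extChartAt (𝓡 n) p).target :=
      (f.contMDiff.comp_contMDiffOn (contMDiffOn_extChartAt_symm p)).contDiffOn
    refine (hf.mul (contDiffOn_const
      (c := (extBasis n).repr (1 : ExteriorAlgebra ℝ (Model n)) S))).congr fun y _ => ?_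
    simp only [coordMVF, Algebra.algebraMap_eq_smul_one, map_smul, map_one,
      Finsupp.smul_apply, smul_eq_mul]⟩

/-! ## Higher connections -/

/-- A higher affine connection on `M`. -/
structure HigherConnection (n : ℕ) (M : Type*) [TopologicalSpace M] [ChartedSpace (Model n) M]
    [IsManifold (𝓡 n) ∞ M] where
  /-- `cov X Y` is `∇_X Y`. -/
  cov : MVF n M → MVF n M → MVF n M
  /-- `∇_X Y ∈ A^(k+l-1)(M)` for `X ∈ A^k(M)`, `Y ∈ A^l(M)`. For `k = l = 0`, where
  `A^(-1)(M) = 0`, this is part of `cov_ofFun_left`. -/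
  hasDegree_cov : ∀ {k l j : ℕ} {X Y : MVF n M}, j + 1 = k + l →
    X.HasDegree k → Y.HasDegree l → (cov X Y).HasDegree j
  /-- `∇_(fX + X') Y = f ∇_X Y + ∇_X' Y`. -/
  cov_linear_left : ∀ (f : C^∞⟮𝓡 n, M; ℝ⟯) (X X' Y : MVF n M),
    cov (ofFun f * X + X') Y = ofFun f * cov X Y + cov X' Y
  /-- `∇_X (Y + Y') = ∇_X Y + ∇_X Y'`. -/
  cov_add_right : ∀ X Y Y' : MVF n M, cov X (Y + Y') = cov X Y + cov X Y'
  /-- `∇_X f = [X, f]`. -/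
  cov_ofFun_right : ∀ {k : ℕ} {X : MVF n M} (f : C^∞⟮𝓡 n, M; ℝ⟯), X.HasDegree k →
    (cov X (ofFun f)).1 = schouten X.1 (ofFun f).1
  /-- `∇_X (f Y) = [X, f] ∧ Y + f ∇_X Y`. -/
  cov_leibniz : ∀ {k : ℕ} {X : MVF n M} (f : C^∞⟮𝓡 n, M; ℝ⟯) (Y : MVF n M), X.HasDegree k →
    (cov X (ofFun f * Y)).1 = schouten X.1 (ofFun f).1 * Y.1 + (ofFun f * cov X Y).1
  /-- `∇_f X = 0`. -/
  cov_ofFun_left : ∀ (f : C^∞⟮𝓡 n, M; ℝ⟯) (X : MVF n M), cov (ofFun f) X = 0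

namespace HigherConnection

variable [IsManifold (𝓡 n) ∞ M]

/-- The higher torsion
`T(X, Y) = ∇_X Y - (-1)^((k-1)(l-1)) ∇_Y X - [X, Y]` for `X ∈ A^k(M)`, `Y ∈ A^l(M)`. -/
def torsion (D : HigherConnection n M) (k l : ℕ) (X Y : MVF n M) : RoughMVF n M :=
  (D.cov X Y).1 - (-1 : ℝ) ^ (((k : ℤ) - 1) * ((l : ℤ) - 1)) • (D.cov Y X).1 - schouten X.1 Y.1

/-- `∇` is almost torsion-free: `T(X, Y) = 0` for all vector fields `X`, `Y`, and for all
`X ∈ A^k(M)`, `Y ∈ A^l(M)` with `X ∧ Y = 0`. -/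
def AlmostTorsionFree (D : HigherConnection n M) : Prop :=
  (∀ X Y : MVF n M, X.HasDegree 1 → Y.HasDegree 1 → D.torsion 1 1 X Y = 0) ∧
  (∀ (k l : ℕ) (X Y : MVF n M), X.HasDegree k → Y.HasDegree l → X * Y = 0 →
    D.torsion k l X Y = 0)

/-- The function `(∇_X α)(Y) = (-1)^((k-1)(l-1)) L_X (i_Y α) - α(∇_X Y)` for `X ∈ A^k(M)`,
`α ∈ Ω^l(M)`, `Y ∈ A^(l-k+1)(M)`, where `k > 0` and `l - k + 1 ≥ 0`. Here `L_X (i_Y α)` is a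
`0`-form; the function is its value on the unit `1 ∈ ∧^0 T_pM`. -/
def covForm (D : HigherConnection n M) (k l : ℕ) (X : MVF n M) (α : RoughForm n M)
    (Y : MVF n M) (p : M) : ℝ :=
  (-1 : ℝ) ^ (((k : ℤ) - 1) * ((l : ℤ) - 1)) * lieDerivForm k X.1 (interior Y.1 α) p 1
    - α p ((D.cov X Y).1 p)

end HigherConnection

/-! ## Associative bilinear forms -/

/-- A smooth fibrewise bilinear form `η` on `∧^• TM` with `η(x ∧ y, z) = η(x, y ∧ z)`. -/
structure AssocForm (n : ℕ) (M : Type*) [TopologicalSpace M] [ChartedSpace (Model n) M] where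
  /-- The bilinear form on the fibre over `p`. -/
  form : (p : M) → ExtFibre n p →ₗ[ℝ] ExtFibre n p →ₗ[ℝ] ℝ
  assoc : ∀ (p : M) (x y z : ExtFibre n p), form p (x * y) z = form p x (y * z)
  smooth : ∀ {k l : ℕ} {X Y : MVF n M}, X.HasDegree k → Y.HasDegree l →
    ContMDiff (𝓡 n) 𝓘(ℝ, ℝ) ∞ (fun p => form p (X.1 p) (Y.1 p))

namespace AssocForm

/-- The `t`-form component `ω^(t)` of `η`, given by `ω^(t)(x) = η(x, 1)` for `x ∈ ∧^t T_pM`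
(and by `0` on `∧^k T_pM`, `k ≠ t`). -/
def component (η : AssocForm n M) (t : ℕ) : RoughForm n M := fun p =>
  (η.form p).flip 1 ∘ₗ GradedAlgebra.proj (fun i => ⋀[ℝ]^i (TangentSpace (𝓡 n) p)) t

/-- The `1`-form component of `η` vanishes and, for each `t > 1`, the component `ω^(t)` is
either identically zero or nowhere zero. -/
def IsNonvanishing (η : AssocForm n M) : Prop :=
  η.component 1 = 0 ∧
  ∀ t : ℕ, 1 < t → η.component t ≠ 0 → ∀ p : M, η.component t p ≠ 0

/-- A form `α` (of positive degree) is multisymplectic if it is closed and, for all `p` and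
`v ∈ T_pM`, one has `i_v α = 0` if and only if `v = 0`. -/
def IsMultisymplectic (α : RoughForm n M) : Prop :=
  extDerivForm α = 0 ∧
  ∀ (p : M) (v : TangentSpace (𝓡 n) p),
    α p ∘ₗ LinearMap.mulLeft ℝ (ExteriorAlgebra.ι ℝ v) = 0 ↔ v = 0

/-- The `1`-form component of `η` vanishes and, for each `t > 1`, the component `ω^(t)` is
either identically zero or multisymplectic. -/
def IsPlectic (η : AssocForm n M) : Prop :=
  η.component 1 = 0 ∧
  ∀ t : ℕ, 1 < t → η.component t ≠ 0 → IsMultisymplectic (η.component t)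

/-- `∇η ≡ 0`: for all `X ∈ A^k(M)`, `Y ∈ A^l(M)`, `Z ∈ A^m(M)` with `k > 0` and `l + m > 0`,
the function `(∇_X η)(Y, Z) = (∇_X ω^(t))(Y ∧ Z)`, `t = k + l + m - 1`, vanishes. -/
def IsParallel [IsManifold (𝓡 n) ∞ M] (η : AssocForm n M) (D : HigherConnection n M) : Prop :=
  ∀ (k l m t : ℕ) (X Y Z : MVF n M), X.HasDegree k → Y.HasDegree l → Z.HasDegree m →
    0 < k → 0 < l + m → t + 1 = k + l + m →
    ∀ p : M, D.covForm k t X (η.component t) (Y * Z) p = 0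

end AssocForm

end Manifold

end HigherConn

end

/-
In a chart, `∇_P Q = ∑ᵢ (-1)^(k-1) (dxⁱ ⌟ P) ∧ ∂ᵢQ`, for `P` of degree `k`, is torsion-free by
graded commutativity. As `ω^(t)` has no zeros, there are smooth multivector fields `u_t` of degree
`t` with `ω^(t)(u_t) = 1`; one adds `∑ₜ cₜ(P, Q) u_t` with `cₜ(P, Q) = ∑ᵢ (∂ᵢω^(t)) ((-1)^(k-1)
(dxⁱ ⌟ P) ∧ Q)` for `Q` of positive degree, which is exactly what makes the `ω^(t)` parallel. This
does not change the torsion where it has to vanish: on two vector fields the correction is zero for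
degree reasons, since `ω^(1) = 0`; and if `P ∧ Q = 0`, then it is graded symmetric in `P` and `Q`,
because `dxⁱ ⌟ (P ∧ Q) = 0`. All the conditions are affine in `∇`, and the bracket and `d` are
natural under changes of coordinates, so the connections in the charts can be glued by a partition
of unity. Finally, a multisymplectic form vanishes nowhere unless `T_pM = 0`, in which case
there are no forms of positive degree.
-/

noncomputable section

namespace HigherConn

/-! ## Contractions in the exterior algebra -/

section ExteriorAlgebra

variable {R V W : Type*} [CommRing R] [AddCommGroup V] [Module R V] [AddCommGroup W] [Module R W]

/-- The grade involution of `∧^• V`, acting by `(-1)^k` on `∧^k V`. -/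
abbrev gradeInvolution : ExteriorAlgebra R V →ₐ[R] ExteriorAlgebra R V :=
  CliffordAlgebra.involute (Q := (0 : QuadraticForm R V))

/-- The contraction `d ⌟ x` of a multivector with a covector `d`, in the first slot. -/
abbrev contraction (d : Module.Dual R V) : ExteriorAlgebra R V →ₗ[R] ExteriorAlgebra R V :=
  CliffordAlgebra.contractLeft (Q := (0 : QuadraticForm R V)) d

theorem exteriorAlgebra_left_induction {C : ExteriorAlgebra R V → Prop} (x : ExteriorAlgebra R V)
    (algebraMap : ∀ r : R, C (algebraMap R (ExteriorAlgebra R V) r))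
    (add : ∀ x y, C x → C y → C (x + y))
    (ι_mul : ∀ x v, C x → C (ExteriorAlgebra.ι R v * x)) : C x :=
  CliffordAlgebra.left_induction (Q := (0 : QuadraticForm R V)) (P := C) algebraMap add ι_mul x

theorem exteriorPower_left_induction {C : ℕ → ExteriorAlgebra R V → Prop} {k : ℕ}
    {x : ExteriorAlgebra R V} (hx : x ∈ ⋀[R]^k V)
    (algebraMap : ∀ r : R, C 0 (algebraMap R (ExteriorAlgebra R V) r))
    (add : ∀ k x y, C k x → C k y → C k (x + y))
    (ι_mul : ∀ k x v, x ∈ ⋀[R]^k V → C k x → C (k + 1) (ExteriorAlgebra.ι R v * x)) : C k x := by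
  refine Submodule.pow_induction_on_left' (M := LinearMap.range (ExteriorAlgebra.ι R))
    (C := fun k x _ => C k x) algebraMap (fun x y i _ _ hx hy => add i x y hx hy) ?_ hx
  rintro _ ⟨v, rfl⟩ i x hx hC
  exact ι_mul i x v hx hC

theorem gradeInvolution_ι (v : V) :
    gradeInvolution (ExteriorAlgebra.ι R v) = -ExteriorAlgebra.ι R v :=
  CliffordAlgebra.involute_ι v

theorem contraction_algebraMap (d : Module.Dual R V) (r : R) :
    contraction d (algebraMap R (ExteriorAlgebra R V) r) = 0 :=
  CliffordAlgebra.contractLeft_algebraMap (0 : QuadraticForm R V) d r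

theorem contraction_ι_mul (d : Module.Dual R V) (v : V) (x : ExteriorAlgebra R V) :
    contraction d (ExteriorAlgebra.ι R v * x) =
      d v • x - ExteriorAlgebra.ι R v * contraction d x :=
  CliffordAlgebra.contractLeft_ι_mul d v x

theorem ι_mul_ι_eq_neg (v w : V) :
    ExteriorAlgebra.ι R v * ExteriorAlgebra.ι R w =
      -(ExteriorAlgebra.ι R w * ExteriorAlgebra.ι R v) :=
  eq_neg_of_add_eq_zero_left (ExteriorAlgebra.ι_add_mul_swap v w)

theorem contraction_mul (d : Module.Dual R V) (x y : ExteriorAlgebra R V) :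
    contraction d (x * y) = contraction d x * y + gradeInvolution x * contraction d y := by
  induction x using exteriorAlgebra_left_induction with
  | algebraMap r =>
    rw [contraction_algebraMap, zero_mul, zero_add, AlgHom.commutes, ← Algebra.smul_def,
      ← Algebra.smul_def, map_smul]
  | add a b ha hb => simp only [add_mul, map_add, ha, hb]; abel
  | ι_mul x v h =>
    rw [mul_assoc, contraction_ι_mul, contraction_ι_mul, h, map_mul, gradeInvolution_ι]
    simp only [mul_add, sub_mul, smul_mul_assoc, neg_mul, mul_assoc]
    abel

theorem ι_mul_eq_gradeInvolution_mul_ι (v : V) (x : ExteriorAlgebra R V) :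
    ExteriorAlgebra.ι R v * x = gradeInvolution x * ExteriorAlgebra.ι R v := by
  induction x using exteriorAlgebra_left_induction with
  | algebraMap r => rw [AlgHom.commutes]; exact (Algebra.commutes r _).symm
  | add a b ha hb => simp only [mul_add, map_add, add_mul, ha, hb]
  | ι_mul x w h =>
    rw [← mul_assoc, ι_mul_ι_eq_neg, neg_mul, mul_assoc, h, map_mul, gradeInvolution_ι]
    simp only [neg_mul, mul_assoc]

theorem gradeInvolution_map (A : V →ₗ[R] W) (x : ExteriorAlgebra R V) :
    gradeInvolution (ExteriorAlgebra.map A x) = ExteriorAlgebra.map A (gradeInvolution x) := by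
  induction x using exteriorAlgebra_left_induction with
  | algebraMap r => simp only [AlgHom.commutes]
  | add a b ha hb => simp only [map_add, ha, hb]
  | ι_mul x w h =>
    simp only [map_mul, h, gradeInvolution_ι, ExteriorAlgebra.map_apply_ι, map_neg]

theorem contraction_map (A : V →ₗ[R] W) (d : Module.Dual R W) (x : ExteriorAlgebra R V) :
    contraction d (ExteriorAlgebra.map A x) =
      ExteriorAlgebra.map A (contraction (d ∘ₗ A) x) := by
  induction x using exteriorAlgebra_left_induction with
  | algebraMap r => simp only [AlgHom.commutes, contraction_algebraMap, map_zero]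
  | add a b ha hb => simp only [map_add, ha, hb]
  | ι_mul x w h =>
    rw [map_mul, ExteriorAlgebra.map_apply_ι, contraction_ι_mul, contraction_ι_mul, h, map_sub,
      map_smul, map_mul, ExteriorAlgebra.map_apply_ι, LinearMap.comp_apply]

theorem ι_mul_mem_exteriorPower {k : ℕ} (v : V) {x : ExteriorAlgebra R V} (hx : x ∈ ⋀[R]^k V) :
    ExteriorAlgebra.ι R v * x ∈ ⋀[R]^(k + 1) V := by
  change _ ∈ LinearMap.range (ExteriorAlgebra.ι R) ^ (k + 1)
  rw [pow_succ']
  exact Submodule.mul_mem_mul ⟨v, rfl⟩ hx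

theorem exists_algebraMap_eq_of_mem_exteriorPower_zero {x : ExteriorAlgebra R V}
    (hx : x ∈ ⋀[R]^0 V) : ∃ r, algebraMap R (ExteriorAlgebra R V) r = x :=
  Submodule.mem_one.1 (by simpa only [pow_zero] using hx)

theorem gradeInvolution_of_mem {k : ℕ} {x : ExteriorAlgebra R V} (hx : x ∈ ⋀[R]^k V) :
    gradeInvolution x = (-1 : R) ^ k • x := by
  refine exteriorPower_left_induction
    (C := fun k x => gradeInvolution x = (-1 : R) ^ k • x) hx ?_ ?_ ?_
  · intro r; rw [AlgHom.commutes, pow_zero, one_smul]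
  · intro k x y hx hy; rw [map_add, hx, hy, smul_add]
  · intro k x v _ h
    rw [map_mul, h, gradeInvolution_ι, pow_succ, mul_neg_one, neg_smul, mul_smul_comm, neg_mul,
      smul_neg]

theorem contraction_eq_zero_of_mem_zero (d : Module.Dual R V) {x : ExteriorAlgebra R V}
    (hx : x ∈ ⋀[R]^0 V) : contraction d x = 0 := by
  obtain ⟨r, rfl⟩ := exists_algebraMap_eq_of_mem_exteriorPower_zero hx
  exact contraction_algebraMap d r

theorem contraction_mem_pred (d : Module.Dual R V) {k : ℕ} {x : ExteriorAlgebra R V}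
    (hx : x ∈ ⋀[R]^k V) : contraction d x ∈ ⋀[R]^(k - 1) V := by
  refine exteriorPower_left_induction (C := fun k x => contraction d x ∈ ⋀[R]^(k - 1) V) hx
    ?_ ?_ ?_
  · intro r; rw [contraction_algebraMap]; exact zero_mem _
  · intro k x y hx hy; rw [map_add]; exact add_mem hx hy
  · intro k x v hx h
    rw [contraction_ι_mul, Nat.add_sub_cancel]
    refine sub_mem (Submodule.smul_mem _ _ hx) ?_
    cases k with
    | zero => rw [contraction_eq_zero_of_mem_zero d hx, mul_zero]; exact zero_mem _
    | succ k => exact ι_mul_mem_exteriorPower v h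

theorem contraction_mem (d : Module.Dual R V) {k : ℕ} {x : ExteriorAlgebra R V}
    (hx : x ∈ ⋀[R]^(k + 1) V) : contraction d x ∈ ⋀[R]^k V :=
  contraction_mem_pred d hx

theorem mul_comm_of_mem {k l : ℕ} {x y : ExteriorAlgebra R V} (hx : x ∈ ⋀[R]^k V)
    (hy : y ∈ ⋀[R]^l V) : x * y = (-1 : R) ^ (k * l) • (y * x) := by
  refine exteriorPower_left_induction
    (C := fun k x => x * y = (-1 : R) ^ (k * l) • (y * x)) hx ?_ ?_ ?_
  · intro r; rw [Algebra.commutes, zero_mul, pow_zero, one_smul]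
  · intro k a b ha hb; rw [add_mul, mul_add, ha, hb, smul_add]
  · intro k x v _ h
    rw [mul_assoc, h, mul_smul_comm, ← mul_assoc, ι_mul_eq_gradeInvolution_mul_ι,
      gradeInvolution_of_mem hy, smul_mul_assoc, smul_mul_assoc, smul_smul, ← pow_add, mul_assoc,
      add_one_mul]

theorem map_mem_exteriorPower (A : V →ₗ[R] W) {k : ℕ} {x : ExteriorAlgebra R V}
    (hx : x ∈ ⋀[R]^k V) : ExteriorAlgebra.map A x ∈ ⋀[R]^k W := by
  refine exteriorPower_left_induction (C := fun k x => ExteriorAlgebra.map A x ∈ ⋀[R]^k W) hx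
    ?_ ?_ ?_
  · intro r; rw [AlgHom.commutes]; exact SetLike.algebraMap_mem_graded _ r
  · intro k x y hx hy; rw [map_add]; exact add_mem hx hy
  · intro k x v _ h
    rw [map_mul, ExteriorAlgebra.map_apply_ι]
    exact ι_mul_mem_exteriorPower (A v) h

/-- The projection of `∧^• V` onto its degree `k` part. -/
abbrev degreeProj (k : ℕ) : ExteriorAlgebra R V →ₗ[R] ExteriorAlgebra R V :=
  GradedAlgebra.proj (fun i => ⋀[R]^i V) k

theorem degreeProj_of_mem {k : ℕ} {x : ExteriorAlgebra R V} (hx : x ∈ ⋀[R]^k V) (l : ℕ) :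
    degreeProj l x = if k = l then x else 0 := by
  split_ifs with h
  · subst h
    exact DirectSum.decompose_of_mem_same (fun i : ℕ => ⋀[R]^i V) hx
  · exact DirectSum.decompose_of_mem_ne (fun i : ℕ => ⋀[R]^i V) hx h

/-- The part of positive degree of a multivector. -/
abbrev positivePart : ExteriorAlgebra R V →ₗ[R] ExteriorAlgebra R V :=
  LinearMap.id - degreeProj 0

theorem positivePart_of_mem {k : ℕ} {x : ExteriorAlgebra R V} (hx : x ∈ ⋀[R]^k V) :
    positivePart x = if k = 0 then 0 else x := by
  rw [LinearMap.sub_apply, LinearMap.id_apply, degreeProj_of_mem hx]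
  split_ifs
  · exact sub_self x
  · exact sub_zero x

theorem positivePart_mem {k : ℕ} {x : ExteriorAlgebra R V} (hx : x ∈ ⋀[R]^k V) :
    positivePart x ∈ ⋀[R]^k V := by
  rw [positivePart_of_mem hx]
  split_ifs
  · exact zero_mem _
  · exact hx

/-- The covectors of degree `t` on `∧^• V`, i.e. those vanishing on `∧^s V` for `s ≠ t`. -/
def homogeneousCovectors (R V : Type*) [CommRing R] [AddCommGroup V] [Module R V] (t : ℕ) :
    Submodule R (Module.Dual R (ExteriorAlgebra R V)) :=
  ⨅ (s : ℕ) (_ : s ≠ t), (⋀[R]^s V).dualAnnihilator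

theorem mem_homogeneousCovectors {t : ℕ} {β : Module.Dual R (ExteriorAlgebra R V)} :
    β ∈ homogeneousCovectors R V t ↔ ∀ s ≠ t, ∀ x ∈ ⋀[R]^s V, β x = 0 := by
  simp only [homogeneousCovectors, Submodule.mem_iInf, Submodule.mem_dualAnnihilator]

/-- The bilinear map `(x, z) ↦ (-1)^(k-1) (d ⌟ x) ∧ z`, `k = deg x`. -/
def signedContractionMul (d : Module.Dual R V) :
    ExteriorAlgebra R V →ₗ[R] ExteriorAlgebra R V →ₗ[R] ExteriorAlgebra R V :=
  LinearMap.mul R (ExteriorAlgebra R V) ∘ₗ gradeInvolution.toLinearMap ∘ₗ contraction d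

section SignedContractionMul

variable (d : Module.Dual R V) {k l : ℕ} {x z : ExteriorAlgebra R V}

theorem signedContractionMul_apply (x z : ExteriorAlgebra R V) :
    signedContractionMul d x z = gradeInvolution (contraction d x) * z := rfl

theorem signedContractionMul_of_mem_zero (hx : x ∈ ⋀[R]^0 V) (z : ExteriorAlgebra R V) :
    signedContractionMul d x z = 0 := by
  rw [signedContractionMul_apply, contraction_eq_zero_of_mem_zero d hx, map_zero, zero_mul]

theorem signedContractionMul_positivePart (hx : x ∈ ⋀[R]^k V) (z : ExteriorAlgebra R V) :
    signedContractionMul d (positivePart x) z = signedContractionMul d x z := by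
  rw [positivePart_of_mem hx]
  split_ifs with hk
  · subst hk
    rw [signedContractionMul_of_mem_zero d hx, map_zero, LinearMap.zero_apply]
  · rfl

theorem signedContractionMul_mem {j : ℕ} (hx : x ∈ ⋀[R]^k V) (hz : z ∈ ⋀[R]^l V)
    (hj : j + 1 = k + l) : signedContractionMul d x z ∈ ⋀[R]^j V := by
  rw [signedContractionMul_apply]
  cases k with
  | zero =>
    rw [contraction_eq_zero_of_mem_zero d hx, map_zero, zero_mul]
    exact zero_mem _
  | succ k =>
    obtain rfl : j = k + l := by lia
    have hd := contraction_mem d hx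
    rw [gradeInvolution_of_mem hd, smul_mul_assoc]
    exact Submodule.smul_mem _ _ (SetLike.mul_mem_graded hd hz)

theorem gradeInvolution_contraction (x : ExteriorAlgebra R V) :
    gradeInvolution (contraction d x) = -contraction d (gradeInvolution x) := by
  induction x using exteriorAlgebra_left_induction with
  | algebraMap r => simp only [AlgHom.commutes, contraction_algebraMap, map_zero, neg_zero]
  | add a b ha hb => rw [map_add, map_add, ha, hb, map_add, map_add, neg_add]
  | ι_mul x v h =>
    rw [contraction_ι_mul, map_sub, map_smul, map_mul, map_mul, h, gradeInvolution_ι, neg_mul_neg,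
      neg_mul, map_neg, neg_neg, contraction_ι_mul]

-- Contracting `x̂ ∧ z = ± x ∧ z = 0`, where `x̂` is the grade involution of `x`.
theorem signedContractionMul_of_mul_eq_zero (hx : x ∈ ⋀[R]^k V) (hxz : x * z = 0) :
    signedContractionMul d x z = x * contraction d z := by
  have h := contraction_mul d (gradeInvolution x) z
  rw [CliffordAlgebra.involute_involute, ← neg_neg (contraction d (gradeInvolution x)),
    ← gradeInvolution_contraction, gradeInvolution_of_mem hx, smul_mul_assoc, hxz, smul_zero,
    map_zero, neg_mul, eq_comm, neg_add_eq_zero] at h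
  exact h

end SignedContractionMul

section Torsion

variable {K U : Type*} [Field K] [AddCommGroup U] [Module K U] (d : Module.Dual K U) {k l : ℕ}
  {x z : ExteriorAlgebra K U} (hx : x ∈ ⋀[K]^k U) (hz : z ∈ ⋀[K]^l U)
include hx hz

theorem mul_contraction_eq_signedContractionMul :
    z * contraction d x =
      (-1 : K) ^ (((k : ℤ) - 1) * ((l : ℤ) - 1)) • signedContractionMul d x z := by
  rw [signedContractionMul_apply]
  cases k with
  | zero => rw [contraction_eq_zero_of_mem_zero d hx, map_zero, zero_mul, mul_zero, smul_zero]
  | succ k =>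
    have hd := contraction_mem d hx
    have hsign : Even ((((k + 1 : ℕ) : ℤ) - 1) * (l - 1) + k + (k * l : ℕ)) :=
      ⟨k * l, by push_cast; ring⟩
    rw [gradeInvolution_of_mem hd, smul_mul_assoc, mul_comm_of_mem hd hz, smul_smul, smul_smul,
      ← zpow_natCast, ← zpow_natCast, ← zpow_add₀ (by simp), ← zpow_add₀ (by simp),
      hsign.neg_one_zpow, one_smul]

theorem signedContractionMul_torsion (hxz : x * z = 0) :
    signedContractionMul d x z =
      (-1 : K) ^ (((k : ℤ) - 1) * ((l : ℤ) - 1)) • signedContractionMul d z x := by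
  rw [signedContractionMul_of_mul_eq_zero d hx hxz,
    mul_contraction_eq_signedContractionMul d hz hx, mul_comm ((k : ℤ) - 1)]

theorem signedContractionMul_positivePart_torsion (hxz : x * z = 0) :
    signedContractionMul d x (positivePart z) =
      (-1 : K) ^ (((k : ℤ) - 1) * ((l : ℤ) - 1)) • signedContractionMul d z (positivePart x) := by
  rw [← signedContractionMul_positivePart d hx, ← signedContractionMul_positivePart d hz]
  refine signedContractionMul_torsion d (positivePart_mem hx) (positivePart_mem hz) ?_
  rw [positivePart_of_mem hx, positivePart_of_mem hz]
  split_ifs <;> simp only [zero_mul, mul_zero, hxz]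

end Torsion

section Basis

variable {I : Type*} [LinearOrder I] (b : Module.Basis I R V)

theorem exteriorAlgebra_basis_mem (s : Finset I) : b.ExteriorAlgebra s ∈ ⋀[R]^s.card V := by
  rw [ExteriorAlgebra.basis_apply_ofCard b rfl]
  exact Subtype.prop (exteriorPower.ιMulti_family R s.card b ⟨s, rfl⟩)

theorem exteriorAlgebra_repr_degreeProj (k : ℕ) (x : ExteriorAlgebra R V) (s : Finset I) :
    b.ExteriorAlgebra.repr (degreeProj k x) s =
      if s.card = k then b.ExteriorAlgebra.repr x s else 0 := by
  suffices b.ExteriorAlgebra.coord s ∘ₗ degreeProj k =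
      if s.card = k then b.ExteriorAlgebra.coord s else 0 by
    have h := LinearMap.congr_fun this x
    split_ifs at h ⊢ <;> exact h
  refine b.ExteriorAlgebra.ext fun t => ?_
  rw [LinearMap.comp_apply, degreeProj_of_mem (exteriorAlgebra_basis_mem b t)]
  by_cases hts : t = s
  · subst hts; split_ifs <;> simp
  · split_ifs <;> simp [hts]

theorem mem_exteriorPower_iff_repr {k : ℕ} {x : ExteriorAlgebra R V} :
    x ∈ ⋀[R]^k V ↔ ∀ s : Finset I, s.card ≠ k → b.ExteriorAlgebra.repr x s = 0 := by
  constructor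
  · intro hx s hs
    have h := exteriorAlgebra_repr_degreeProj b k x s
    rwa [degreeProj_of_mem hx, if_pos rfl, if_neg hs] at h
  · intro h
    suffices degreeProj k x = x from this ▸ Subtype.prop _
    refine b.ExteriorAlgebra.ext_elem_iff.2 fun s => ?_
    rw [exteriorAlgebra_repr_degreeProj]
    exact ite_eq_left_iff.2 fun hs => (h s hs).symm

include b in
theorem eq_zero_of_mem_exteriorPower_of_card_lt [Fintype I] {k : ℕ} (hk : Fintype.card I < k)
    {x : ExteriorAlgebra R V} (hx : x ∈ ⋀[R]^k V) : x = 0 := by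
  refine b.ExteriorAlgebra.ext_elem_iff.2 fun s => ?_
  rw [map_zero, Finsupp.zero_apply]
  exact (mem_exteriorPower_iff_repr b).1 hx s (s.card_le_univ.trans_lt hk).ne

end Basis

section DualBases

variable {I J : Type*} [Fintype I] [Fintype J] (b : Module.Basis I R V) (b' : Module.Basis J R W)
  {F : Type*} [AddCommGroup F] [Module R F]

-- The canonical element `∑ᵢ bᵢ ⊗ bⁱ` of `V ⊗ V*` does not depend on the basis.
theorem sum_bilin_contraction_map (B : W →ₗ[R] ExteriorAlgebra R W →ₗ[R] F) (A : V →ₗ[R] W)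
    (x : ExteriorAlgebra R V) :
    ∑ j, B (b' j) (contraction (b'.coord j) (ExteriorAlgebra.map A x)) =
      ∑ i, B (A (b i)) (ExteriorAlgebra.map A (contraction (b.coord i) x)) := by
  have hdual : ∀ j, contraction (b'.coord j) (ExteriorAlgebra.map A x) =
      ∑ i, b'.coord j (A (b i)) • ExteriorAlgebra.map A (contraction (b.coord i) x) := by
    intro j
    rw [contraction_map, ← b.sum_dual_apply_smul_coord (b'.coord j ∘ₗ A)]
    simp only [map_sum, map_smul, LinearMap.sum_apply, LinearMap.smul_apply,
      LinearMap.comp_apply]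
  simp only [hdual, map_sum, map_smul]
  rw [Finset.sum_comm]
  refine Finset.sum_congr rfl fun i _ => ?_
  conv_rhs => rw [← b'.sum_repr (A (b i))]
  simp only [map_sum, map_smul, LinearMap.sum_apply, LinearMap.smul_apply, Module.Basis.coord_apply]

variable (A : V →ₗ[R] W)

theorem sum_bilin_contraction_ι_mul (B : V →ₗ[R] ExteriorAlgebra R V →ₗ[R] F) (v : V)
    (x : ExteriorAlgebra R V) :
    ∑ i, B (b i) (contraction (b.coord i) (ExteriorAlgebra.ι R v * x)) =
      B v x - ∑ i, B (b i) (ExteriorAlgebra.ι R v * contraction (b.coord i) x) := by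
  simp only [contraction_ι_mul, map_sub, map_smul, Finset.sum_sub_distrib]
  congr 1
  conv_rhs => rw [← b.sum_repr v]
  simp only [map_sum, map_smul, LinearMap.sum_apply, LinearMap.smul_apply,
    Module.Basis.coord_apply]

theorem sum_bilin_contraction_ιMulti {k : ℕ} (B : V →ₗ[R] ExteriorAlgebra R V →ₗ[R] F)
    (v : Fin (k + 1) → V) :
    ∑ i, B (b i) (contraction (b.coord i) (ExteriorAlgebra.ιMulti R (k + 1) v)) =
      ∑ j : Fin (k + 1), (-1 : R) ^ (j : ℕ) •
        B (v j) (ExteriorAlgebra.ιMulti R k (j.removeNth v)) := by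
  induction k generalizing B with
  | zero =>
    rw [ExteriorAlgebra.ιMulti_succ_apply, sum_bilin_contraction_ι_mul]
    simp
  | succ k ih =>
    have htail := ih (B.compl₂ (LinearMap.mulLeft R (ExteriorAlgebra.ι R (v 0)))) (Matrix.vecTail v)
    simp only [LinearMap.compl₂_apply, LinearMap.mulLeft_apply] at htail
    rw [ExteriorAlgebra.ιMulti_succ_apply, sum_bilin_contraction_ι_mul, Fin.sum_univ_succ, htail,
      sub_eq_add_neg, ← Finset.sum_neg_distrib, Fin.val_zero, pow_zero, one_smul]
    refine congrArg₂ _ rfl (Finset.sum_congr rfl fun j _ => ?_)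
    rw [Fin.val_succ, pow_succ, mul_neg_one, neg_smul, ExteriorAlgebra.ιMulti_succ_apply]
    congr 5
    funext l
    simp [Fin.removeNth, Matrix.vecTail]

/-- The differential of `A ↦ ∧^• A` at `A` in the direction `B`; in the basis `b` it is
`x ↦ ∑ᵢ B bᵢ ∧ (∧^• A) (bⁱ ⌟ x)`. -/
def extVariation (B : V →ₗ[R] W) : ExteriorAlgebra R V →ₗ[R] ExteriorAlgebra R W :=
  ∑ i, LinearMap.mulLeft R (ExteriorAlgebra.ι R (B (b i))) ∘ₗ
    (ExteriorAlgebra.map A).toLinearMap ∘ₗ contraction (b.coord i)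

theorem extVariation_apply (B : V →ₗ[R] W) (x : ExteriorAlgebra R V) :
    extVariation b A B x =
      ∑ i, ExteriorAlgebra.ι R (B (b i)) * ExteriorAlgebra.map A (contraction (b.coord i) x) := by
  simp only [extVariation, LinearMap.sum_apply, LinearMap.comp_apply, LinearMap.mulLeft_apply,
    AlgHom.toLinearMap_apply]

theorem extVariation_algebraMap (B : V →ₗ[R] W) (r : R) :
    extVariation b A B (algebraMap R _ r) = 0 := by
  simp only [extVariation_apply, contraction_algebraMap, map_zero, mul_zero, Finset.sum_const_zero]

theorem extVariation_ι_mul (B : V →ₗ[R] W) (v : V) (x : ExteriorAlgebra R V) :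
    extVariation b A B (ExteriorAlgebra.ι R v * x) =
      ExteriorAlgebra.ι R (A v) * extVariation b A B x +
        ExteriorAlgebra.ι R (B v) * ExteriorAlgebra.map A x := by
  have h := sum_bilin_contraction_ι_mul b ((LinearMap.mul R (ExteriorAlgebra R W)).compl₁₂
    (ExteriorAlgebra.ι R ∘ₗ B) (ExteriorAlgebra.map A).toLinearMap) v x
  simp only [LinearMap.compl₁₂_apply, LinearMap.comp_apply, LinearMap.mul_apply',
    AlgHom.toLinearMap_apply, map_mul, ExteriorAlgebra.map_apply_ι] at h
  rw [extVariation_apply, h, extVariation_apply, Finset.mul_sum, sub_eq_add_neg, add_comm,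
    ← Finset.sum_neg_distrib]
  refine congrArg (· + _) (Finset.sum_congr rfl fun i _ => ?_)
  rw [← mul_assoc, ← mul_assoc, ← neg_mul, ι_mul_ι_eq_neg (A v)]

variable {H : V →ₗ[R] V →ₗ[R] W} (hH : ∀ v w, H v w = H w v)
include hH

theorem sum_extVariation_contraction_eq_zero (x : ExteriorAlgebra R V) :
    ∑ i, extVariation b A (H (b i)) (contraction (b.coord i) x) = 0 := by
  simp only [extVariation_apply]
  rw [← Finset.sum_product']
  refine Finset.sum_involution (fun ij _ => ij.swap) (fun ij _ => ?_) (fun ij _ hne hij => hne ?_)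
    (fun _ _ => Finset.mem_univ _) (fun ij _ => ij.swap_swap)
  · rw [Prod.fst_swap, Prod.snd_swap, hH, contraction, contraction,
      CliffordAlgebra.contractLeft_comm, map_neg, mul_neg, neg_add_cancel]
  · rw [← hij, Prod.fst_swap, Prod.snd_swap, show ij.1 = ij.2 from congrArg Prod.snd hij,
      contraction, CliffordAlgebra.contractLeft_contractLeft, map_zero, mul_zero]

theorem sum_contraction_mul_extVariation_comm (x y : ExteriorAlgebra R V) :
    ∑ i, ExteriorAlgebra.map A (gradeInvolution (contraction (b.coord i) x)) *
        extVariation b A (H (b i)) y =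
      ∑ i, extVariation b A (H (b i)) x *
        ExteriorAlgebra.map A (contraction (b.coord i) y) := by
  simp only [extVariation_apply, Finset.mul_sum, Finset.sum_mul, ← mul_assoc,
    ← gradeInvolution_map, ← ι_mul_eq_gradeInvolution_mul_ι]
  rw [Finset.sum_comm]
  simp only [hH]

end DualBases

end ExteriorAlgebra

/-! ## Differential calculus with multivector fields -/

section Calculus

section FiniteDimensional

variable {E F G H : Type*} [NormedAddCommGroup E] [NormedSpace ℝ E] [NormedAddCommGroup F]
  [NormedSpace ℝ F] [NormedAddCommGroup G] [NormedSpace ℝ G] [NormedAddCommGroup H]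
  [NormedSpace ℝ H] {f : H → E} {g : H → F} {x : H}

theorem contDiffAt_iff_repr {ι : Type*} [Finite ι] (b : Module.Basis ι ℝ E) {m : WithTop ℕ∞} :
    ContDiffAt ℝ m f x ↔ ∀ i, ContDiffAt ℝ m (fun z => b.repr (f z) i) x :=
  have := Fintype.ofFinite ι
  (b.equivFunL.comp_contDiffAt_iff (f := f)).symm.trans contDiffAt_pi

variable [FiniteDimensional ℝ E] [FiniteDimensional ℝ F]

theorem contDiffAt_linearMap_comp {m : WithTop ℕ∞} (L : E →ₗ[ℝ] G) (hf : ContDiffAt ℝ m f x) :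
    ContDiffAt ℝ m (fun z => L (f z)) x :=
  L.toContinuousLinearMap.contDiff.contDiffAt.comp x hf

theorem fderiv_linearMap_comp (L : E →ₗ[ℝ] G) (hf : DifferentiableAt ℝ f x) (v : H) :
    fderiv ℝ (fun z => L (f z)) x v = L (fderiv ℝ f x v) :=
  congrArg (· v) (L.toContinuousLinearMap.hasFDerivAt.comp x hf.hasFDerivAt).fderiv

theorem contDiffAt_bilin {m : WithTop ℕ∞} (B : E →ₗ[ℝ] F →ₗ[ℝ] G) (hf : ContDiffAt ℝ m f x)
    (hg : ContDiffAt ℝ m g x) : ContDiffAt ℝ m (fun z => B (f z) (g z)) x :=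
  B.toContinuousBilinearMap.isBoundedBilinearMap.contDiff.contDiffAt.comp x (hf.prodMk hg)

theorem fderiv_bilin (B : E →ₗ[ℝ] F →ₗ[ℝ] G) (hf : DifferentiableAt ℝ f x)
    (hg : DifferentiableAt ℝ g x) (v : H) :
    fderiv ℝ (fun z => B (f z) (g z)) x v =
      B (f x) (fderiv ℝ g x v) + B (fderiv ℝ f x v) (g x) :=
  congrArg (· v)
    (B.toContinuousBilinearMap.hasFDerivAt_of_bilinear hf.hasFDerivAt hg.hasFDerivAt).fderiv

theorem fderiv_mem_of_eventually_mem {S : Submodule ℝ E} (hf : DifferentiableAt ℝ f x)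
    (hS : ∀ᶠ z in 𝓝 x, f z ∈ S) (v : H) : fderiv ℝ f x v ∈ S := by
  by_contra hv
  obtain ⟨L, hLv, hLS⟩ := Submodule.exists_le_ker_of_notMem hv
  have hconst : (fun z => L (f z)) =ᶠ[𝓝 x] fun _ => 0 := hS.mono fun z hz => hLS hz
  refine hLv ?_
  rw [← fderiv_linearMap_comp L hf, hconst.fderiv_eq, fderiv_fun_const]
  rfl

end FiniteDimensional

/-- The exterior algebra of the model space. -/
abbrev Ext (n : ℕ) : Type := ExteriorAlgebra ℝ (Model n)

variable {n m : ℕ}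

instance extNormedAddCommGroup : NormedAddCommGroup (Ext n) :=
  NormedAddCommGroup.induced (Ext n) (Finset (Fin n) → ℝ) (extBasis n).equivFun
    (extBasis n).equivFun.injective

instance extNormedSpace : NormedSpace ℝ (Ext n) :=
  NormedSpace.induced ℝ (Ext n) (Finset (Fin n) → ℝ) (extBasis n).equivFun

instance extFiniteDimensional : FiniteDimensional ℝ (Ext n) :=
  (extBasis n).finiteDimensional_of_finite

instance extDualNormedAddCommGroup : NormedAddCommGroup (Module.Dual ℝ (Ext n)) :=
  NormedAddCommGroup.induced (Module.Dual ℝ (Ext n)) (Finset (Fin n) → ℝ)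
    (extBasis n).dualBasis.equivFun (extBasis n).dualBasis.equivFun.injective

instance extDualNormedSpace : NormedSpace ℝ (Module.Dual ℝ (Ext n)) :=
  NormedSpace.induced ℝ (Module.Dual ℝ (Ext n)) (Finset (Fin n) → ℝ)
    (extBasis n).dualBasis.equivFun

theorem contr_eq (i : Fin n) (x : Ext n) : contr i x = contraction ((stdBasis n).coord i) x := rfl

theorem contDiffAt_ext_iff {H : Type*} [NormedAddCommGroup H] [NormedSpace ℝ H] {P : H → Ext n}
    {y : H} {k : WithTop ℕ∞} :
    ContDiffAt ℝ k P y ↔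
      ∀ S : Finset (Fin n), ContDiffAt ℝ k (fun z => (extBasis n).repr (P z) S) y :=
  contDiffAt_iff_repr (extBasis n)

theorem contDiffAt_extDual_iff {H : Type*} [NormedAddCommGroup H] [NormedSpace ℝ H]
    {β : H → Module.Dual ℝ (Ext n)} {y : H} {k : WithTop ℕ∞} :
    ContDiffAt ℝ k β y ↔
      ∀ S : Finset (Fin n), ContDiffAt ℝ k (fun z => β z (extBasis n S)) y := by
  simp only [contDiffAt_iff_repr (extBasis n).dualBasis, Module.Basis.dualBasis_repr]

theorem partialMV_eq_fderiv {P : Model n → Ext n} {y : Model n} (hP : DifferentiableAt ℝ P y)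
    (i : Fin n) : partialMV P i y = fderiv ℝ P y (stdBasis n i) := by
  rw [← (extBasis n).sum_repr (fderiv ℝ P y (stdBasis n i))]
  exact Finset.sum_congr rfl fun S _ =>
    congrArg (· • _) (fderiv_linearMap_comp ((extBasis n).coord S) hP (stdBasis n i))

section ExtMap

/-- `∧^• A` as a continuous linear map, so that the calculus of continuous linear maps applies to
its dependence on `A`. -/
def extMapCLM (A : Model n →L[ℝ] Model m) : Ext n →L[ℝ] Ext m :=
  (ExteriorAlgebra.map A.toLinearMap).toLinearMap.toContinuousLinearMap

theorem extMapCLM_apply (A : Model n →L[ℝ] Model m) (x : Ext n) :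
    extMapCLM A x = ExteriorAlgebra.map A.toLinearMap x := rfl

theorem extMapCLM_ι_mul (A : Model n →L[ℝ] Model m) (v : Model n) (x : Ext n) :
    extMapCLM A (ExteriorAlgebra.ι ℝ v * x) = ExteriorAlgebra.ι ℝ (A v) * extMapCLM A x := by
  simp only [extMapCLM_apply, map_mul, ExteriorAlgebra.map_apply_ι, ContinuousLinearMap.coe_coe]

/-- The map `A ↦ A v`, with values in `∧¹`. -/
def ιEvalCLM (m : ℕ) (v : Model n) : (Model n →L[ℝ] Model m) →L[ℝ] Ext m :=
  (ExteriorAlgebra.ι ℝ).toContinuousLinearMap ∘L ContinuousLinearMap.apply ℝ (Model m) v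

theorem contDiff_extMapCLM {k : WithTop ℕ∞} :
    ContDiff ℝ k (extMapCLM : (Model n →L[ℝ] Model m) → Ext n →L[ℝ] Ext m) := by
  refine contDiff_clm_apply_iff.2 fun x => ?_
  induction x using exteriorAlgebra_left_induction with
  | algebraMap r => simp only [extMapCLM_apply, AlgHom.commutes]; exact contDiff_const
  | add x y hx hy => simp only [map_add]; exact hx.add hy
  | ι_mul x v hx =>
    simp only [extMapCLM_ι_mul]
    exact contDiff_iff_contDiffAt.2 fun A => contDiffAt_bilin (LinearMap.mul ℝ (Ext m))
      (ιEvalCLM m v).contDiff.contDiffAt hx.contDiffAt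

theorem fderiv_extMapCLM_apply (A B : Model n →L[ℝ] Model m) (x : Ext n) :
    fderiv ℝ extMapCLM A B x = extVariation (stdBasis n) A.toLinearMap B.toLinearMap x := by
  have hdiff : Differentiable ℝ (extMapCLM (n := n) (m := m)) :=
    contDiff_extMapCLM.differentiable one_ne_zero
  have heval : ∀ x : Ext n, fderiv ℝ extMapCLM A B x = fderiv ℝ (fun C => extMapCLM C x) A B :=
    fun x => (congrArg (· B) (((ContinuousLinearMap.apply ℝ (Ext m) x).hasFDerivAt.comp A
      (hdiff A).hasFDerivAt).fderiv)).symm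
  induction x using exteriorAlgebra_left_induction with
  | algebraMap r =>
    rw [heval, extVariation_algebraMap]
    simp only [extMapCLM_apply, AlgHom.commutes, fderiv_fun_const]
    rfl
  | add x y hx hy => rw [map_add, map_add, hx, hy]
  | ι_mul x v hx =>
    rw [heval]
    simp only [extMapCLM_ι_mul]
    refine (fderiv_bilin (LinearMap.mul ℝ (Ext m)) (ιEvalCLM m v).differentiableAt
      ((hdiff A).clm_apply (differentiableAt_const x)) B).trans ?_
    rw [← heval, hx, extVariation_ι_mul, (ιEvalCLM m v).fderiv]
    rfl

variable {H : Type*} [NormedAddCommGroup H] [NormedSpace ℝ H] {A : H → Model n →L[ℝ] Model m}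
  {P : H → Ext n} {y : H}

theorem contDiffAt_extMap {k : WithTop ℕ∞} (hA : ContDiffAt ℝ k A y) (hP : ContDiffAt ℝ k P y) :
    ContDiffAt ℝ k (fun z => ExteriorAlgebra.map (A z).toLinearMap (P z)) y :=
  (contDiff_extMapCLM.contDiffAt.comp y hA).clm_apply hP

theorem differentiableAt_extMap (hA : DifferentiableAt ℝ A y) (hP : DifferentiableAt ℝ P y) :
    DifferentiableAt ℝ (fun z => ExteriorAlgebra.map (A z).toLinearMap (P z)) y :=
  ((contDiff_extMapCLM.differentiable one_ne_zero (A y)).comp y hA).clm_apply hP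

theorem fderiv_extMap (hA : DifferentiableAt ℝ A y) (hP : DifferentiableAt ℝ P y) (v : H) :
    fderiv ℝ (fun z => ExteriorAlgebra.map (A z).toLinearMap (P z)) y v =
      extVariation (stdBasis n) (A y).toLinearMap (fderiv ℝ A y v).toLinearMap (P y) +
        ExteriorAlgebra.map (A y).toLinearMap (fderiv ℝ P y v) := by
  have hmap := (contDiff_extMapCLM (n := n) (m := m)).differentiable one_ne_zero (A y)
  refine (congrArg (· v) (fderiv_clm_apply (hmap.comp y hA) hP)).trans ?_
  rw [fderiv_comp y hmap hA, ← fderiv_extMapCLM_apply, add_comm]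
  rfl

end ExtMap

end Calculus

/-! ## Naturality of the bracket and of the exterior derivative -/

section ChangeOfCoordinates

variable {n m : ℕ}

/-- `P'` is the push-forward of the multivector field `P` under `g`, near `y`. -/
def IsPushforwardAt (g : Model n → Model m) (y : Model n) (P : Model n → Ext n)
    (P' : Model m → Ext m) : Prop :=
  ∀ᶠ z in 𝓝 y, P' (g z) = ExteriorAlgebra.map (fderiv ℝ g z).toLinearMap (P z)

/-- `β` is the pull-back of the inhomogeneous form `β'` under `g`, near `y`. -/
def IsPullbackAt (g : Model n → Model m) (y : Model n) (β : Model n → Module.Dual ℝ (Ext n))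
    (β' : Model m → Module.Dual ℝ (Ext m)) : Prop :=
  ∀ᶠ z in 𝓝 y, β z = β' (g z) ∘ₗ (ExteriorAlgebra.map (fderiv ℝ g z).toLinearMap).toLinearMap

/-- The exterior derivative in coordinates, `(dβ)(x) = ∑ᵢ (∂ᵢβ)(dxⁱ ⌟ x)`; unlike
`extDerivLocal` it does not refer to the degrees. -/
def coordExtDeriv (β : Model n → Module.Dual ℝ (Ext n)) (y : Model n) : Module.Dual ℝ (Ext n) :=
  ∑ i, fderiv ℝ β y (stdBasis n i) ∘ₗ contraction ((stdBasis n).coord i)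

theorem coordExtDeriv_apply (β : Model n → Module.Dual ℝ (Ext n)) (y : Model n) (x : Ext n) :
    coordExtDeriv β y x =
      ∑ i, fderiv ℝ β y (stdBasis n i) (contraction ((stdBasis n).coord i) x) :=
  LinearMap.sum_apply _ _ _

/-- The second derivative of `g`, as a bilinear map. -/
def hessian (g : Model n → Model m) (y : Model n) : Model n →ₗ[ℝ] Model n →ₗ[ℝ] Model m :=
  (fderiv ℝ (fderiv ℝ g) y).toLinearMap₁₂

/-- The second order term `x ↦ D_v(∧^• Dg) x` in the transformation law of first derivatives. -/
abbrev hessianTerm (g : Model n → Model m) (y v : Model n) : Ext n →ₗ[ℝ] Ext m :=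
  extVariation (stdBasis n) (fderiv ℝ g y).toLinearMap (hessian g y v)

variable {g : Model n → Model m} {y : Model n} (hg : ContDiffAt ℝ ∞ g y)
  {P Q : Model n → Ext n} {P' Q' : Model m → Ext m} {β : Model n → Module.Dual ℝ (Ext n)}
  {β' : Model m → Module.Dual ℝ (Ext m)}
include hg

theorem differentiableAt_fderiv : DifferentiableAt ℝ (fderiv ℝ g) y :=
  (hg.fderiv_right (m := 1) (by norm_cast)).differentiableAt one_ne_zero

theorem hessian_comm (v w : Model n) : hessian g y v w = hessian g y w v :=
  hg.isSymmSndFDerivAt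
    (by simp only [minSmoothness_of_isRCLikeNormedField]; norm_cast) v w

theorem fderiv_of_isPushforwardAt (h : IsPushforwardAt g y P P') (hP : DifferentiableAt ℝ P y)
    (hP' : DifferentiableAt ℝ P' (g y)) (v : Model n) :
    fderiv ℝ P' (g y) (fderiv ℝ g y v) =
      hessianTerm g y v (P y) +
        ExteriorAlgebra.map (fderiv ℝ g y).toLinearMap (fderiv ℝ P y v) := by
  refine Eq.trans ?_ (fderiv_extMap (differentiableAt_fderiv hg) hP v)
  rw [← Filter.EventuallyEq.fderiv_eq h]
  exact (congrArg (· v) (fderiv_comp y hP' (hg.differentiableAt (by simp)))).symm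

theorem fderiv_of_isPullbackAt (h : IsPullbackAt g y β β') (hβ : DifferentiableAt ℝ β y)
    (hβ' : DifferentiableAt ℝ β' (g y)) (v : Model n) (x : Ext n) :
    fderiv ℝ β y v x =
      β' (g y) (hessianTerm g y v x) +
        fderiv ℝ β' (g y) (fderiv ℝ g y v)
          (ExteriorAlgebra.map (fderiv ℝ g y).toLinearMap x) := by
  have hgd : DifferentiableAt ℝ g y := hg.differentiableAt (by simp)
  have heval := fderiv_linearMap_comp (LinearMap.applyₗ x : Module.Dual ℝ (Ext n) →ₗ[ℝ] ℝ) hβ v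
  have hpull : (fun z => β z x) =ᶠ[𝓝 y] fun z =>
      (LinearMap.id : Module.Dual ℝ (Ext m) →ₗ[ℝ] Ext m →ₗ[ℝ] ℝ) (β' (g z))
        (ExteriorAlgebra.map (fderiv ℝ g z).toLinearMap x) :=
    h.mono fun z hz => LinearMap.congr_fun hz x
  refine heval.symm.trans ((DFunLike.congr_fun hpull.fderiv_eq v).trans ?_)
  refine (fderiv_bilin _ (f := fun z => β' (g z)) (hβ'.comp y hgd)
    (differentiableAt_extMap (differentiableAt_fderiv hg) (differentiableAt_const x)) v).trans ?_
  rw [fderiv_extMap (differentiableAt_fderiv hg) (differentiableAt_const x), fderiv_fun_const,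
    show fderiv ℝ (fun z => β' (g z)) y v = fderiv ℝ β' (g y) (fderiv ℝ g y v) from
      congrArg (· v) (fderiv_comp y hβ' hgd)]
  simp only [LinearMap.id_apply, Pi.zero_apply, _root_.zero_apply, map_zero, add_zero]
  rfl

theorem schoutenLocal_of_isPushforwardAt (h : IsPushforwardAt g y P P')
    (hP : DifferentiableAt ℝ P y) (hP' : DifferentiableAt ℝ P' (g y))
    (k : IsPushforwardAt g y Q Q') (hQ : DifferentiableAt ℝ Q y)
    (hQ' : DifferentiableAt ℝ Q' (g y)) :
    schoutenLocal P' Q' (g y) =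
      ExteriorAlgebra.map (fderiv ℝ g y).toLinearMap (schoutenLocal P Q y) := by
  have hfst := sum_bilin_contraction_map (stdBasis n) (stdBasis m)
    ((LinearMap.mul ℝ (Ext m)).flip.compl₁₂ (fderiv ℝ Q' (g y)).toLinearMap
      gradeInvolution.toLinearMap) (fderiv ℝ g y).toLinearMap (P y)
  have hsnd := sum_bilin_contraction_map (stdBasis n) (stdBasis m)
    ((LinearMap.mul ℝ (Ext m)).compl₁₂ (fderiv ℝ P' (g y)).toLinearMap LinearMap.id)
    (fderiv ℝ g y).toLinearMap (Q y)
  simp only [LinearMap.compl₁₂_apply, LinearMap.flip_apply, LinearMap.mul_apply',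
    AlgHom.toLinearMap_apply, ContinuousLinearMap.coe_coe, LinearMap.id_apply,
    fderiv_of_isPushforwardAt hg h hP hP', fderiv_of_isPushforwardAt hg k hQ hQ',
    gradeInvolution_map, mul_add, add_mul, Finset.sum_add_distrib] at hfst hsnd
  simp only [schoutenLocal, contr_eq, partialMV_eq_fderiv hP, partialMV_eq_fderiv hP',
    partialMV_eq_fderiv hQ, partialMV_eq_fderiv hQ', h.self_of_nhds, k.self_of_nhds, map_sum,
    map_sub, map_mul, Finset.sum_sub_distrib]
  rw [hfst, hsnd, sum_contraction_mul_extVariation_comm (stdBasis n) _ (hessian_comm hg),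
    add_sub_add_left_eq_sub]

theorem coordExtDeriv_of_isPullbackAt (h : IsPullbackAt g y β β') (hβ : DifferentiableAt ℝ β y)
    (hβ' : DifferentiableAt ℝ β' (g y)) :
    coordExtDeriv β y =
      coordExtDeriv β' (g y) ∘ₗ (ExteriorAlgebra.map (fderiv ℝ g y).toLinearMap).toLinearMap := by
  refine LinearMap.ext fun x => ?_
  have hcontr : coordExtDeriv β' (g y) (ExteriorAlgebra.map (fderiv ℝ g y).toLinearMap x) =
      ∑ i, fderiv ℝ β' (g y) (fderiv ℝ g y (stdBasis n i)) (ExteriorAlgebra.map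
        (fderiv ℝ g y).toLinearMap (contraction ((stdBasis n).coord i) x)) :=
    (coordExtDeriv_apply _ _ _).trans (sum_bilin_contraction_map (stdBasis n) (stdBasis m)
      (fderiv ℝ β' (g y)).toLinearMap (fderiv ℝ g y).toLinearMap x)
  rw [LinearMap.comp_apply, AlgHom.toLinearMap_apply, hcontr, coordExtDeriv_apply]
  simp only [fderiv_of_isPullbackAt hg h hβ hβ', Finset.sum_add_distrib]
  rw [← map_sum, sum_extVariation_contraction_eq_zero (stdBasis n) _ (hessian_comm hg), map_zero,
    zero_add]

end ChangeOfCoordinates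

section ExteriorDerivative

variable {n : ℕ}

/-- The degree `k` part of a covector, as a linear map into continuous alternating forms. -/
def altPartLinear (n k : ℕ) : Module.Dual ℝ (Ext n) →ₗ[ℝ] Model n [⋀^Fin k]→L[ℝ] ℝ where
  toFun := altPart k
  map_add' _ _ := rfl
  map_smul' _ _ := rfl

theorem extDeriv_altPart_apply {β : Model n → Module.Dual ℝ (Ext n)} {y : Model n}
    (hβ : DifferentiableAt ℝ β y) {k : ℕ} (v : Fin (k + 1) → Model n) :
    extDeriv (fun z => altPart k (β z)) y v =
      ∑ j : Fin (k + 1), (-1 : ℝ) ^ (j : ℕ) •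
        fderiv ℝ β y (v j) (ExteriorAlgebra.ιMulti ℝ k (j.removeNth v)) := by
  have hdiff : DifferentiableAt ℝ (fun z => altPart k (β z)) y :=
    (altPartLinear n k).toContinuousLinearMap.differentiableAt.comp y hβ
  rw [extDeriv_apply hdiff]
  refine Finset.sum_congr rfl fun j _ => ?_
  have heval : fderiv ℝ (fun z => altPart k (β z) (j.removeNth v)) y (v j) =
      fderiv ℝ β y (v j) (ExteriorAlgebra.ιMulti ℝ k (j.removeNth v)) :=
    fderiv_linearMap_comp (LinearMap.applyₗ (ExteriorAlgebra.ιMulti ℝ k (j.removeNth v)) :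
      Module.Dual ℝ (Ext n) →ₗ[ℝ] ℝ) hβ (v j)
  rw [heval]
  simp

theorem extDerivLocal_eq_coordExtDeriv {β : Model n → Module.Dual ℝ (Ext n)} {y : Model n}
    (hβ : DifferentiableAt ℝ β y) : extDerivLocal β y = coordExtDeriv β y := by
  refine ExteriorAlgebra.lhom_ext fun k => ?_
  ext v
  rw [LinearMap.compAlternatingMap_apply, LinearMap.compAlternatingMap_apply, extDerivLocal,
    ExteriorAlgebra.liftAlternating_apply_ιMulti, coordExtDeriv_apply]
  cases k with
  | zero => simp
  | succ k =>
    exact (extDeriv_altPart_apply hβ v).trans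
      (sum_bilin_contraction_ιMulti (stdBasis n) (fderiv ℝ β y).toLinearMap v).symm

end ExteriorDerivative

/-! ## The parallel connection in a chart -/

section ChartConnection

variable {n : ℕ}

/-- A multivector on which the covector `β` takes the value `1`; the junk value `0` at `β = 0`. -/
def unitMV (β : Module.Dual ℝ (Ext n)) : Ext n :=
  (∑ S, β (extBasis n S) ^ 2)⁻¹ • ∑ S, β (extBasis n S) • extBasis n S

theorem sum_sq_extBasis_ne_zero {β : Module.Dual ℝ (Ext n)} (hβ : β ≠ 0) :
    ∑ S, β (extBasis n S) ^ 2 ≠ 0 := by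
  intro h
  rw [Finset.sum_eq_zero_iff_of_nonneg fun S _ => sq_nonneg _] at h
  exact hβ ((extBasis n).ext fun S => pow_eq_zero_iff two_ne_zero |>.1 (h S (Finset.mem_univ S)))

theorem apply_unitMV {β : Module.Dual ℝ (Ext n)} (hβ : β ≠ 0) : β (unitMV β) = 1 := by
  rw [unitMV, map_smul, map_sum, smul_eq_mul]
  simp only [map_smul, smul_eq_mul, ← sq]
  exact inv_mul_cancel₀ (sum_sq_extBasis_ne_zero hβ)

theorem unitMV_mem {t : ℕ} {β : Module.Dual ℝ (Ext n)}
    (hβ : β ∈ homogeneousCovectors ℝ (Model n) t) : unitMV β ∈ ⋀[ℝ]^t (Model n) := by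
  refine Submodule.smul_mem _ _ (Submodule.sum_mem _ fun S _ => ?_)
  have hS : extBasis n S ∈ ⋀[ℝ]^S.card (Model n) := exteriorAlgebra_basis_mem (stdBasis n) S
  by_cases h : S.card = t
  · exact Submodule.smul_mem _ _ (h ▸ hS)
  · rw [mem_homogeneousCovectors.1 hβ _ h _ hS, zero_smul]
    exact zero_mem _

/-- The flat connection `∑ᵢ (-1)^(k-1) (dxⁱ ⌟ x) ∧ ∂ᵢQ` of a chart, as a linear map in the
multivector `x` of degree `k`. -/
def flatCov (Q : Model n → Ext n) (y : Model n) : Ext n →ₗ[ℝ] Ext n :=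
  ∑ i, (signedContractionMul ((stdBasis n).coord i)).flip (fderiv ℝ Q y (stdBasis n i))

/-- The coefficient `∑ᵢ (∂ᵢβ)((-1)^(k-1) (dxⁱ ⌟ x) ∧ z)` by which the flat connection fails to
make the form `β` parallel, as a linear form in the multivector `x` of degree `k`. -/
def corrCoeff (β : Model n → Module.Dual ℝ (Ext n)) (y : Model n) (z : Ext n) :
    Module.Dual ℝ (Ext n) :=
  ∑ i, fderiv ℝ β y (stdBasis n i) ∘ₗ (signedContractionMul ((stdBasis n).coord i)).flip z

/-- The higher connection of a chart for which the forms `w t`, `t ∈ T`, are parallel: the value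
`∇_x Q` at `y`, as a linear map in `x`. -/
def chartCov (T : Finset ℕ) (w : ℕ → Model n → Module.Dual ℝ (Ext n)) (Q : Model n → Ext n)
    (y : Model n) : Ext n →ₗ[ℝ] Ext n :=
  flatCov Q y + ∑ t ∈ T, (corrCoeff (w t) y (positivePart (Q y))).smulRight (unitMV (w t y))

theorem flatCov_apply (Q : Model n → Ext n) (y : Model n) (x : Ext n) :
    flatCov Q y x =
      ∑ i, signedContractionMul ((stdBasis n).coord i) x (fderiv ℝ Q y (stdBasis n i)) :=
  LinearMap.sum_apply _ _ _

theorem corrCoeff_apply (β : Model n → Module.Dual ℝ (Ext n)) (y : Model n) (z x : Ext n) :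
    corrCoeff β y z x =
      ∑ i, fderiv ℝ β y (stdBasis n i) (signedContractionMul ((stdBasis n).coord i) x z) :=
  LinearMap.sum_apply _ _ _

theorem chartCov_apply (T : Finset ℕ) (w : ℕ → Model n → Module.Dual ℝ (Ext n))
    (Q : Model n → Ext n) (y : Model n) (x : Ext n) :
    chartCov T w Q y x =
      flatCov Q y x + ∑ t ∈ T, corrCoeff (w t) y (positivePart (Q y)) x • unitMV (w t y) := by
  simp only [chartCov, LinearMap.add_apply, LinearMap.sum_apply, LinearMap.smulRight_apply]

variable {T : Finset ℕ} {w : ℕ → Model n → Module.Dual ℝ (Ext n)}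
  {β : Model n → Module.Dual ℝ (Ext n)} {P Q Q' : Model n → Ext n} {y : Model n} {k l j t : ℕ}
  {x z : Ext n}

section Linearity

theorem flatCov_add (hQ : DifferentiableAt ℝ Q y) (hQ' : DifferentiableAt ℝ Q' y) :
    flatCov (fun z => Q z + Q' z) y = flatCov Q y + flatCov Q' y := by
  simp only [flatCov, fderiv_fun_add hQ hQ', _root_.add_apply, map_add, Finset.sum_add_distrib]

theorem chartCov_add (hQ : DifferentiableAt ℝ Q y) (hQ' : DifferentiableAt ℝ Q' y) :
    chartCov T w (fun z => Q z + Q' z) y = chartCov T w Q y + chartCov T w Q' y := by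
  refine LinearMap.ext fun x => ?_
  simp only [chartCov_apply, flatCov_add hQ hQ', LinearMap.add_apply, corrCoeff_apply, map_add,
    Finset.sum_add_distrib, add_smul]
  abel

theorem chartCov_apply_of_mem_zero (hx : x ∈ ⋀[ℝ]^0 (Model n)) : chartCov T w Q y x = 0 := by
  simp only [chartCov_apply, flatCov_apply, corrCoeff_apply,
    signedContractionMul_of_mem_zero _ hx, map_zero, Finset.sum_const_zero, zero_smul, add_zero]

theorem chartCov_one : chartCov T w (fun _ => 1) y = 0 := by
  have hpos : positivePart (1 : Ext n) = 0 :=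
    (positivePart_of_mem (SetLike.GradedOne.one_mem (A := fun i => ⋀[ℝ]^i (Model n)))).trans
      (if_pos rfl)
  refine LinearMap.ext fun x => ?_
  simp only [chartCov_apply, flatCov_apply, corrCoeff_apply, fderiv_fun_const, Pi.zero_apply,
    _root_.zero_apply, hpos, map_zero, Finset.sum_const_zero, zero_smul, add_zero,
    LinearMap.zero_apply]

variable {f : Model n → ℝ} (hf : DifferentiableAt ℝ f y)
include hf

theorem flatCov_smul (hQ : DifferentiableAt ℝ Q y) :
    flatCov (fun z => f z • Q z) y x =
      flatCov (fun z => algebraMap ℝ (Ext n) (f z)) y x * Q y + f y • flatCov Q y x := by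
  have hconst : ∀ v, fderiv ℝ (fun z => algebraMap ℝ (Ext n) (f z)) y v =
      algebraMap ℝ (Ext n) (fderiv ℝ f y v) :=
    fderiv_linearMap_comp (Algebra.linearMap ℝ (Ext n)) hf
  have hsmul : ∀ v, fderiv ℝ (fun z => f z • Q z) y v =
      algebraMap ℝ (Ext n) (fderiv ℝ f y v) * Q y + f y • fderiv ℝ Q y v := by
    intro v
    rw [fderiv_fun_smul hf hQ, ← Algebra.smul_def, add_comm]
    rfl
  simp only [flatCov_apply, hsmul, hconst, map_add, map_smul, Finset.sum_add_distrib,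
    Finset.sum_mul, Finset.smul_sum, signedContractionMul_apply, mul_assoc]

theorem schoutenLocal_algebraMap :
    schoutenLocal P (fun z => algebraMap ℝ (Ext n) (f z)) y =
      flatCov (fun z => algebraMap ℝ (Ext n) (f z)) y (P y) := by
  have hdiff : DifferentiableAt ℝ (fun z => algebraMap ℝ (Ext n) (f z)) y :=
    (Algebra.linearMap ℝ (Ext n)).toContinuousLinearMap.differentiableAt.comp y hf
  simp only [schoutenLocal, flatCov_apply, contr_eq, contraction_algebraMap, mul_zero, sub_zero,
    partialMV_eq_fderiv hdiff, signedContractionMul_apply]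

theorem chartCov_smul (hQ : DifferentiableAt ℝ Q y) :
    chartCov T w (fun z => f z • Q z) y (P y) =
      schoutenLocal P (fun z => algebraMap ℝ (Ext n) (f z)) y * Q y +
        f y • chartCov T w Q y (P y) := by
  simp only [schoutenLocal_algebraMap hf, chartCov_apply, flatCov_smul hf hQ, corrCoeff_apply,
    map_smul, smul_add, Finset.smul_sum, Finset.sum_smul, smul_assoc, add_assoc]

end Linearity

section Degree

theorem flatCov_mem (hQ : DifferentiableAt ℝ Q y) (hQl : ∀ᶠ z in 𝓝 y, Q z ∈ ⋀[ℝ]^l (Model n))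
    (hx : x ∈ ⋀[ℝ]^k (Model n)) (hj : j + 1 = k + l) : flatCov Q y x ∈ ⋀[ℝ]^j (Model n) := by
  rw [flatCov_apply]
  exact Submodule.sum_mem _ fun i _ =>
    signedContractionMul_mem _ hx (fderiv_mem_of_eventually_mem hQ hQl _) hj

theorem corrCoeff_apply_eq_zero (hβ : DifferentiableAt ℝ β y)
    (hβt : ∀ᶠ z in 𝓝 y, β z ∈ homogeneousCovectors ℝ (Model n) t) (hx : x ∈ ⋀[ℝ]^k (Model n))
    (hz : z ∈ ⋀[ℝ]^l (Model n)) (hj : j + 1 = k + l) (hjt : j ≠ t) : corrCoeff β y z x = 0 := by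
  rw [corrCoeff_apply]
  exact Finset.sum_eq_zero fun i _ => mem_homogeneousCovectors.1
    (fderiv_mem_of_eventually_mem hβ hβt _) j hjt _ (signedContractionMul_mem _ hx hz hj)

variable (hw : ∀ t ∈ T, DifferentiableAt ℝ (w t) y)
  (hwt : ∀ t ∈ T, ∀ᶠ z in 𝓝 y, w t z ∈ homogeneousCovectors ℝ (Model n) t)
include hw hwt

theorem chartCov_mem (hQ : DifferentiableAt ℝ Q y) (hQl : ∀ᶠ z in 𝓝 y, Q z ∈ ⋀[ℝ]^l (Model n))
    (hx : x ∈ ⋀[ℝ]^k (Model n)) (hj : j + 1 = k + l) : chartCov T w Q y x ∈ ⋀[ℝ]^j (Model n) := by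
  rw [chartCov_apply]
  refine add_mem (flatCov_mem hQ hQl hx hj) (Submodule.sum_mem _ fun t ht => ?_)
  by_cases hjt : j = t
  · subst hjt
    exact Submodule.smul_mem _ _ (unitMV_mem (hwt j ht).self_of_nhds)
  · rw [corrCoeff_apply_eq_zero (hw t ht) (hwt t ht) hx (positivePart_mem hQl.self_of_nhds) hj hjt,
      zero_smul]
    exact zero_mem _

theorem chartCov_apply_eq_flatCov (hT : 1 ∉ T) (hQ : Q y ∈ ⋀[ℝ]^1 (Model n))
    (hx : x ∈ ⋀[ℝ]^1 (Model n)) : chartCov T w Q y x = flatCov Q y x := by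
  rw [chartCov_apply, add_eq_left]
  refine Finset.sum_eq_zero fun t ht => ?_
  rw [corrCoeff_apply_eq_zero (j := 1) (hw t ht) (hwt t ht) hx (positivePart_mem hQ) rfl
    fun h => hT (h ▸ ht), zero_smul]

end Degree

section Torsion

theorem flatCov_torsion (hP : DifferentiableAt ℝ P y) (hQ : DifferentiableAt ℝ Q y)
    (hPk : ∀ᶠ z in 𝓝 y, P z ∈ ⋀[ℝ]^k (Model n)) (hQl : Q y ∈ ⋀[ℝ]^l (Model n)) :
    flatCov Q y (P y) - (-1 : ℝ) ^ (((k : ℤ) - 1) * ((l : ℤ) - 1)) • flatCov P y (Q y) =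
      schoutenLocal P Q y := by
  rw [mul_comm ((k : ℤ) - 1)]
  simp only [flatCov_apply, schoutenLocal, contr_eq, Finset.sum_sub_distrib, Finset.smul_sum,
    partialMV_eq_fderiv hP, partialMV_eq_fderiv hQ, signedContractionMul_apply,
    mul_contraction_eq_signedContractionMul _ hQl (fderiv_mem_of_eventually_mem hP hPk _)]

theorem corrCoeff_torsion (hx : x ∈ ⋀[ℝ]^k (Model n)) (hz : z ∈ ⋀[ℝ]^l (Model n))
    (hxz : x * z = 0) :
    corrCoeff β y (positivePart z) x =
      (-1 : ℝ) ^ (((k : ℤ) - 1) * ((l : ℤ) - 1)) * corrCoeff β y (positivePart x) z := by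
  simp only [corrCoeff_apply, signedContractionMul_positivePart_torsion _ hx hz hxz, map_smul,
    smul_eq_mul, Finset.mul_sum]

theorem chartCov_torsion (hP : DifferentiableAt ℝ P y) (hQ : DifferentiableAt ℝ Q y)
    (hPk : ∀ᶠ z in 𝓝 y, P z ∈ ⋀[ℝ]^k (Model n)) (hQl : Q y ∈ ⋀[ℝ]^l (Model n))
    (hPQ : P y * Q y = 0) :
    chartCov T w Q y (P y) - (-1 : ℝ) ^ (((k : ℤ) - 1) * ((l : ℤ) - 1)) • chartCov T w P y (Q y) =
      schoutenLocal P Q y := by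
  simp only [← flatCov_torsion hP hQ hPk hQl, chartCov_apply,
    corrCoeff_torsion hPk.self_of_nhds hQl hPQ, smul_add, Finset.smul_sum, smul_smul,
    add_sub_add_right_eq_sub]

theorem chartCov_torsion_one (hT : 1 ∉ T) (hw : ∀ t ∈ T, DifferentiableAt ℝ (w t) y)
    (hwt : ∀ t ∈ T, ∀ᶠ z in 𝓝 y, w t z ∈ homogeneousCovectors ℝ (Model n) t)
    (hP : DifferentiableAt ℝ P y) (hQ : DifferentiableAt ℝ Q y)
    (hP1 : ∀ᶠ z in 𝓝 y, P z ∈ ⋀[ℝ]^1 (Model n)) (hQ1 : Q y ∈ ⋀[ℝ]^1 (Model n)) :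
    chartCov T w Q y (P y) - (-1 : ℝ) ^ ((((1 : ℕ) : ℤ) - 1) * (((1 : ℕ) : ℤ) - 1)) •
        chartCov T w P y (Q y) = schoutenLocal P Q y := by
  rw [← flatCov_torsion hP hQ hP1 hQ1,
    chartCov_apply_eq_flatCov hw hwt hT hQ1 hP1.self_of_nhds,
    chartCov_apply_eq_flatCov hw hwt hT hP1.self_of_nhds hQ1]

end Torsion

section Parallel

/-- The bilinear map `(β, x) ↦ i_x β`, `(i_x β)(z) = β(x ∧ z)`. -/
def interiorBilin (n : ℕ) : Module.Dual ℝ (Ext n) →ₗ[ℝ] Ext n →ₗ[ℝ] Module.Dual ℝ (Ext n) :=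
  (LinearMap.llcomp ℝ (Ext n) (Ext n) ℝ).compl₂ (LinearMap.mul ℝ (Ext n))

theorem interiorBilin_apply (β : Module.Dual ℝ (Ext n)) (x z : Ext n) :
    interiorBilin n β x z = β (x * z) := rfl

theorem coordExtDeriv_interiorBilin_apply (hβ : DifferentiableAt ℝ β y)
    (hQ : DifferentiableAt ℝ Q y) (x : Ext n) :
    coordExtDeriv (fun z => interiorBilin n (β z) (Q z)) y x =
      ∑ i, (β y (fderiv ℝ Q y (stdBasis n i) * contraction ((stdBasis n).coord i) x) +
        fderiv ℝ β y (stdBasis n i) (Q y * contraction ((stdBasis n).coord i) x)) := by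
  simp only [coordExtDeriv_apply, fderiv_bilin (interiorBilin n) hβ hQ, LinearMap.add_apply,
    interiorBilin_apply]

theorem coordExtDeriv_interiorBilin_eq (hβ : DifferentiableAt ℝ β y) (hQ : DifferentiableAt ℝ Q y)
    (hx : x ∈ ⋀[ℝ]^k (Model n)) (hQl : ∀ᶠ z in 𝓝 y, Q z ∈ ⋀[ℝ]^l (Model n)) :
    coordExtDeriv (fun z => interiorBilin n (β z) (Q z)) y x =
      (-1 : ℝ) ^ (((k : ℤ) - 1) * ((l : ℤ) - 1)) *
        (β y (flatCov Q y x) + corrCoeff β y (Q y) x) := by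
  simp only [coordExtDeriv_interiorBilin_apply hβ hQ, flatCov_apply, corrCoeff_apply, map_sum,
    mul_contraction_eq_signedContractionMul _ hx (fderiv_mem_of_eventually_mem hQ hQl _),
    mul_contraction_eq_signedContractionMul _ hx hQl.self_of_nhds, map_smul, smul_eq_mul,
    ← mul_add, ← Finset.mul_sum, ← Finset.sum_add_distrib]

theorem apply_chartCov (ht : t ∈ T) (hw : ∀ s ∈ T, w s y ∈ homogeneousCovectors ℝ (Model n) s)
    (hw0 : w t y ≠ 0) (x : Ext n) :
    w t y (chartCov T w Q y x) =
      w t y (flatCov Q y x) + corrCoeff (w t) y (positivePart (Q y)) x := by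
  rw [chartCov_apply, map_add, map_sum, Finset.sum_eq_single_of_mem t ht, map_smul,
    apply_unitMV hw0, smul_eq_mul, mul_one]
  intro s hs hst
  rw [map_smul, mem_homogeneousCovectors.1 (hw t ht) s hst _ (unitMV_mem (hw s hs)), smul_zero]

theorem coordExtDeriv_interiorBilin_eq_apply_chartCov (ht : t ∈ T)
    (hw : ∀ s ∈ T, w s y ∈ homogeneousCovectors ℝ (Model n) s) (hwd : DifferentiableAt ℝ (w t) y)
    (hw0 : w t y ≠ 0) (hQ : DifferentiableAt ℝ Q y) (hx : x ∈ ⋀[ℝ]^k (Model n)) (hl : 0 < l)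
    (hQl : ∀ᶠ z in 𝓝 y, Q z ∈ ⋀[ℝ]^l (Model n)) :
    coordExtDeriv (fun z => interiorBilin n (w t z) (Q z)) y x =
      (-1 : ℝ) ^ (((k : ℤ) - 1) * ((l : ℤ) - 1)) * w t y (chartCov T w Q y x) := by
  rw [apply_chartCov ht hw hw0, positivePart_of_mem hQl.self_of_nhds, if_neg hl.ne',
    coordExtDeriv_interiorBilin_eq hwd hQ hx hQl]

end Parallel

section Smoothness

theorem contDiffAt_fderiv_apply {E F : Type*} [NormedAddCommGroup E] [NormedSpace ℝ E]
    [NormedAddCommGroup F] [NormedSpace ℝ F] {f : E → F} {y : E} (hf : ContDiffAt ℝ ∞ f y)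
    (v : E) : ContDiffAt ℝ ∞ (fun z => fderiv ℝ f z v) y :=
  (hf.fderiv_right (m := ∞) (by norm_cast)).clm_apply contDiffAt_const

theorem contDiffAt_unitMV (hβ : ContDiffAt ℝ ∞ β y) (hβ0 : β y ≠ 0) :
    ContDiffAt ℝ ∞ (fun z => unitMV (β z)) y := by
  have hS := contDiffAt_extDual_iff.1 hβ
  have hnum : ContDiffAt ℝ ∞ (fun z => ∑ S, β z (extBasis n S) • extBasis n S) y :=
    ContDiffAt.sum fun S _ => (hS S).smul contDiffAt_const
  have hden : ContDiffAt ℝ ∞ (fun z => ∑ S, β z (extBasis n S) ^ 2) y :=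
    ContDiffAt.sum fun S _ => (hS S).pow 2
  exact (hden.inv (sum_sq_extBasis_ne_zero hβ0)).smul hnum

theorem contDiffAt_flatCov (hP : ContDiffAt ℝ ∞ P y) (hQ : ContDiffAt ℝ ∞ Q y) :
    ContDiffAt ℝ ∞ (fun z => flatCov Q z (P z)) y := by
  simp only [flatCov_apply]
  exact ContDiffAt.sum fun i _ => contDiffAt_bilin _ hP (contDiffAt_fderiv_apply hQ _)

theorem contDiffAt_corrCoeff (hβ : ContDiffAt ℝ ∞ β y) (hP : ContDiffAt ℝ ∞ P y)
    (hQ : ContDiffAt ℝ ∞ Q y) : ContDiffAt ℝ ∞ (fun z => corrCoeff β z (Q z) (P z)) y := by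
  simp only [corrCoeff_apply]
  exact ContDiffAt.sum fun i _ =>
    contDiffAt_bilin (LinearMap.id : Module.Dual ℝ (Ext n) →ₗ[ℝ] Ext n →ₗ[ℝ] ℝ)
      (contDiffAt_fderiv_apply hβ _) (contDiffAt_bilin _ hP hQ)

theorem contDiffAt_chartCov (hw : ∀ t ∈ T, ContDiffAt ℝ ∞ (w t) y) (hw0 : ∀ t ∈ T, w t y ≠ 0)
    (hP : ContDiffAt ℝ ∞ P y) (hQ : ContDiffAt ℝ ∞ Q y) :
    ContDiffAt ℝ ∞ (fun z => chartCov T w Q z (P z)) y := by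
  simp only [chartCov_apply]
  refine (contDiffAt_flatCov hP hQ).add (ContDiffAt.sum fun t ht => ?_)
  have hcoeff := contDiffAt_corrCoeff (hw t ht) hP (contDiffAt_linearMap_comp positivePart hQ)
  exact hcoeff.smul (contDiffAt_unitMV (hw t ht) (hw0 t ht))

end Smoothness

end ChartConnection

/-! ## Multivector fields and forms in charts -/

section Charts

variable {n : ℕ} {M : Type*} [TopologicalSpace M] [ChartedSpace (Model n) M] {a b q : M}
  {X Y : RoughMVF n M} {α : RoughForm n M}

theorem eventually_nhds_extChartAt_iff (hb : q ∈ (extChartAt (𝓡 n) b).source)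
    {p : Model n → Prop} :
    (∀ᶠ z in 𝓝 (extChartAt (𝓡 n) b q), p z) ↔ ∀ᶠ r in 𝓝 q, p (extChartAt (𝓡 n) b r) := by
  have hmap := map_extChartAt_nhds' (I := 𝓡 n) hb
  rw [ModelWithCorners.range_eq_univ, nhdsWithin_univ] at hmap
  rw [← hmap, Filter.eventually_map]

variable (n) in
/-- The coordinate change from the chart around `b` to the chart around `a`. -/
def coordChange (a b : M) : Model n → Model n :=
  extChartAt (𝓡 n) a ∘ (extChartAt (𝓡 n) b).symm

theorem coordChange_extChartAt (hb : q ∈ (extChartAt (𝓡 n) b).source) :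
    coordChange n a b (extChartAt (𝓡 n) b q) = extChartAt (𝓡 n) a q :=
  congrArg (extChartAt (𝓡 n) a) ((extChartAt (𝓡 n) b).left_inv hb)

theorem coordMVF_extChartAt (ha : q ∈ (extChartAt (𝓡 n) a).source) (X : RoughMVF n M) :
    coordMVF X a (extChartAt (𝓡 n) a q) = chartExt a q (X q) := by
  rw [coordMVF, (extChartAt (𝓡 n) a).left_inv ha]

theorem coordForm_extChartAt (ha : q ∈ (extChartAt (𝓡 n) a).source) (α : RoughForm n M) :
    coordForm α a (extChartAt (𝓡 n) a q) = α q ∘ₗ (chartExtInv a q).toLinearMap := by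
  rw [coordForm, (extChartAt (𝓡 n) a).left_inv ha]

theorem contDiffAt_coordMVF (hX : IsSmoothMVF X) (ha : q ∈ (extChartAt (𝓡 n) a).source) :
    ContDiffAt ℝ ∞ (coordMVF X a) (extChartAt (𝓡 n) a q) :=
  contDiffAt_ext_iff.2 fun S => (hX a S).contDiffAt <|
    (isOpen_extChartAt_target a).mem_nhds ((extChartAt (𝓡 n) a).map_source ha)

theorem differentiableAt_coordMVF (hX : IsSmoothMVF X) (ha : q ∈ (extChartAt (𝓡 n) a).source) :
    DifferentiableAt ℝ (coordMVF X a) (extChartAt (𝓡 n) a q) :=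
  (contDiffAt_coordMVF hX ha).differentiableAt (by simp)

/-- A differential form is smooth if it is smooth in the charts. -/
def IsSmoothForm (α : RoughForm n M) : Prop :=
  ∀ a q : M, q ∈ (extChartAt (𝓡 n) a).source →
    ContDiffAt ℝ ∞ (coordForm α a) (extChartAt (𝓡 n) a q)

theorem differentiableAt_coordForm (hα : IsSmoothForm α)
    (ha : q ∈ (extChartAt (𝓡 n) a).source) :
    DifferentiableAt ℝ (coordForm α a) (extChartAt (𝓡 n) a q) :=
  (hα a q ha).differentiableAt (by simp)

variable [IsManifold (𝓡 n) ∞ M]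

section ChartDifferential

theorem contDiffAt_coordChange (ha : q ∈ (extChartAt (𝓡 n) a).source)
    (hb : q ∈ (extChartAt (𝓡 n) b).source) :
    ContDiffAt ℝ ∞ (coordChange n a b) (extChartAt (𝓡 n) b q) := by
  have hmem : extChartAt (𝓡 n) b q ∈
      ((extChartAt (𝓡 n) b).symm ≫ extChartAt (𝓡 n) a).source := by
    refine ⟨(extChartAt (𝓡 n) b).map_source hb, ?_⟩
    change (extChartAt (𝓡 n) b).symm (extChartAt (𝓡 n) b q) ∈
      (extChartAt (𝓡 n) a).source
    rwa [(extChartAt (𝓡 n) b).left_inv hb]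
  have h := contDiffWithinAt_ext_coord_change (I := 𝓡 n) (n := ∞) a b hmem
  rwa [ModelWithCorners.range_eq_univ, contDiffWithinAt_univ] at h

theorem chartDiff_eq_fderiv_coordChange_comp (ha : q ∈ (extChartAt (𝓡 n) a).source)
    (hb : q ∈ (extChartAt (𝓡 n) b).source) :
    chartDiff a q =
      (fderiv ℝ (coordChange n a b) (extChartAt (𝓡 n) b q)).comp (chartDiff b q) := by
  have hchart : MDifferentiableAt (𝓡 n) 𝓘(ℝ, Model n) (extChartAt (𝓡 n) b) q :=
    mdifferentiableAt_extChartAt (by rwa [extChartAt_source] at hb)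
  have hchange : MDifferentiableAt 𝓘(ℝ, Model n) 𝓘(ℝ, Model n) (coordChange n a b)
      (extChartAt (𝓡 n) b q) :=
    ((contDiffAt_coordChange ha hb).differentiableAt (by simp)).mdifferentiableAt
  have hchain := mfderiv_comp q hchange hchart
  rw [mfderiv_eq_fderiv] at hchain
  refine Eq.trans (Filter.EventuallyEq.mfderiv_eq ?_) hchain
  filter_upwards [extChartAt_source_mem_nhds' hb] with r hr
  exact (coordChange_extChartAt hr).symm

theorem chartExt_eq_map_coordChange (ha : q ∈ (extChartAt (𝓡 n) a).source)
    (hb : q ∈ (extChartAt (𝓡 n) b).source) (x : ExtFibre n q) :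
    chartExt a q x = ExteriorAlgebra.map
      (fderiv ℝ (coordChange n a b) (extChartAt (𝓡 n) b q)).toLinearMap (chartExt b q x) := by
  rw [chartExt, chartDiff_eq_fderiv_coordChange_comp ha hb, chartExt, ← AlgHom.comp_apply,
    ExteriorAlgebra.map_comp_map]
  rfl

theorem chartExt_chartExtInv (ha : q ∈ (extChartAt (𝓡 n) a).source) (x : Ext n) :
    chartExt a q (chartExtInv a q x) = x := by
  have hinv : (chartDiff (n := n) a q).IsInvertible := isInvertible_mfderiv_extChartAt ha
  have hcomp : (chartDiff (n := n) a q).toLinearMap ∘ₗ (chartDiff a q).inverse.toLinearMap =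
      LinearMap.id := LinearMap.ext hinv.self_apply_inverse
  rw [chartExt, chartExtInv, ← AlgHom.comp_apply, ExteriorAlgebra.map_comp_map, hcomp,
    ExteriorAlgebra.map_id]
  rfl

theorem chartExtInv_chartExt (ha : q ∈ (extChartAt (𝓡 n) a).source) (x : ExtFibre n q) :
    chartExtInv a q (chartExt a q x) = x := by
  have hinv : (chartDiff (n := n) a q).IsInvertible := isInvertible_mfderiv_extChartAt ha
  have hcomp : (chartDiff (n := n) a q).inverse.toLinearMap ∘ₗ (chartDiff a q).toLinearMap =
      LinearMap.id := LinearMap.ext hinv.inverse_apply_self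
  rw [chartExt, chartExtInv, ← AlgHom.comp_apply, ExteriorAlgebra.map_comp_map, hcomp,
    ExteriorAlgebra.map_id]
  rfl

theorem coordForm_extChartAt_chartExt (ha : q ∈ (extChartAt (𝓡 n) a).source) (α : RoughForm n M)
    (x : ExtFibre n q) : coordForm α a (extChartAt (𝓡 n) a q) (chartExt a q x) = α q x := by
  rw [coordForm_extChartAt ha, LinearMap.comp_apply, AlgHom.toLinearMap_apply,
    chartExtInv_chartExt ha]

theorem coordForm_extChartAt_ne_zero (ha : q ∈ (extChartAt (𝓡 n) a).source) (hα : α q ≠ 0) :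
    coordForm α a (extChartAt (𝓡 n) a q) ≠ 0 := by
  contrapose! hα
  exact LinearMap.ext fun x => by rw [← coordForm_extChartAt_chartExt ha, hα]; rfl

end ChartDifferential

section ChangeOfChart

variable (ha : q ∈ (extChartAt (𝓡 n) a).source) (hb : q ∈ (extChartAt (𝓡 n) b).source)
include ha hb

theorem isPushforwardAt_coordMVF (X : RoughMVF n M) :
    IsPushforwardAt (coordChange n a b) (extChartAt (𝓡 n) b q) (coordMVF X b)
      (coordMVF X a) := by
  refine (eventually_nhds_extChartAt_iff hb).2 ?_
  filter_upwards [extChartAt_source_mem_nhds' ha, extChartAt_source_mem_nhds' hb] with r hra hrb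
  rw [coordChange_extChartAt hrb, coordMVF_extChartAt hra, coordMVF_extChartAt hrb,
    chartExt_eq_map_coordChange hra hrb]

theorem isPullbackAt_coordForm (α : RoughForm n M) :
    IsPullbackAt (coordChange n a b) (extChartAt (𝓡 n) b q) (coordForm α b)
      (coordForm α a) := by
  refine (eventually_nhds_extChartAt_iff hb).2 ?_
  filter_upwards [extChartAt_source_mem_nhds' ha, extChartAt_source_mem_nhds' hb] with r hra hrb
  refine LinearMap.ext fun x => ?_
  rw [← chartExt_chartExtInv hrb x, coordForm_extChartAt_chartExt hrb, LinearMap.comp_apply,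
    AlgHom.toLinearMap_apply, coordChange_extChartAt hrb, ← chartExt_eq_map_coordChange hra hrb,
    coordForm_extChartAt_chartExt hra]

theorem contDiffAt_coordMVF_of_contDiffAt
    (h : ContDiffAt ℝ ∞ (coordMVF X a) (extChartAt (𝓡 n) a q)) :
    ContDiffAt ℝ ∞ (coordMVF X b) (extChartAt (𝓡 n) b q) := by
  have hpush : ContDiffAt ℝ ∞ (fun z => ExteriorAlgebra.map
      (fderiv ℝ (coordChange n b a) z).toLinearMap (coordMVF X a z)) (extChartAt (𝓡 n) a q) :=
    contDiffAt_extMap ((contDiffAt_coordChange hb ha).fderiv_right (by norm_cast)) h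
  rw [← coordChange_extChartAt hb] at hpush
  refine (hpush.comp _ (contDiffAt_coordChange ha hb)).congr_of_eventuallyEq ?_
  refine (eventually_nhds_extChartAt_iff hb).2 ?_
  filter_upwards [extChartAt_source_mem_nhds' ha, extChartAt_source_mem_nhds' hb] with r hra hrb
  rw [Function.comp_apply, coordChange_extChartAt hrb, coordMVF_extChartAt hra,
    coordMVF_extChartAt hrb, chartExt_eq_map_coordChange hrb hra]

theorem contDiffAt_coordForm_of_contDiffAt
    (h : ContDiffAt ℝ ∞ (coordForm α a) (extChartAt (𝓡 n) a q)) :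
    ContDiffAt ℝ ∞ (coordForm α b) (extChartAt (𝓡 n) b q) := by
  have hg := contDiffAt_coordChange ha hb
  rw [← coordChange_extChartAt hb] at h
  refine contDiffAt_extDual_iff.2 fun S => ?_
  have hpush : ContDiffAt ℝ ∞ (fun z => ExteriorAlgebra.map
      (fderiv ℝ (coordChange n a b) z).toLinearMap (extBasis n S)) (extChartAt (𝓡 n) b q) :=
    contDiffAt_extMap (hg.fderiv_right (by norm_cast)) contDiffAt_const
  refine (contDiffAt_bilin (LinearMap.id : Module.Dual ℝ (Ext n) →ₗ[ℝ] Ext n →ₗ[ℝ] ℝ)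
    (h.comp _ hg) hpush).congr_of_eventuallyEq ?_
  filter_upwards [isPullbackAt_coordForm ha hb α] with z hz
  rw [hz]
  rfl

end ChangeOfChart

theorem isSmoothMVF_of_contDiffAt
    (h : ∀ q : M, ∃ a : M, q ∈ (extChartAt (𝓡 n) a).source ∧
      ContDiffAt ℝ ∞ (coordMVF X a) (extChartAt (𝓡 n) a q)) : IsSmoothMVF X := by
  intro b S y hy
  obtain ⟨a, ha, hX⟩ := h ((extChartAt (𝓡 n) b).symm y)
  have hXb := contDiffAt_coordMVF_of_contDiffAt ha ((extChartAt (𝓡 n) b).map_target hy) hX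
  rw [(extChartAt (𝓡 n) b).right_inv hy] at hXb
  exact (contDiffAt_ext_iff.1 hXb S).contDiffWithinAt

theorem chartExt_schouten (hX : IsSmoothMVF X) (hY : IsSmoothMVF Y)
    (ha : q ∈ (extChartAt (𝓡 n) a).source) :
    chartExt a q (schouten X Y q) =
      schoutenLocal (coordMVF X a) (coordMVF Y a) (extChartAt (𝓡 n) a q) := by
  have hq := mem_extChartAt_source (I := 𝓡 n) q
  have hdiff : ∀ {Z : RoughMVF n M}, IsSmoothMVF Z → DifferentiableAt ℝ (coordMVF Z a)
      (coordChange n a q (extChartAt (𝓡 n) q q)) := fun hZ => by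
    rw [coordChange_extChartAt hq]
    exact differentiableAt_coordMVF hZ ha
  rw [chartExt_eq_map_coordChange ha hq, schouten, chartExt_chartExtInv hq,
    ← schoutenLocal_of_isPushforwardAt (contDiffAt_coordChange ha hq)
      (isPushforwardAt_coordMVF ha hq X) (differentiableAt_coordMVF hX hq) (hdiff hX)
      (isPushforwardAt_coordMVF ha hq Y) (differentiableAt_coordMVF hY hq) (hdiff hY),
    coordChange_extChartAt hq]

theorem extDerivForm_apply (hα : IsSmoothForm α) (ha : q ∈ (extChartAt (𝓡 n) a).source)
    (x : ExtFibre n q) :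
    extDerivForm α q x =
      coordExtDeriv (coordForm α a) (extChartAt (𝓡 n) a q) (chartExt a q x) := by
  have hq := mem_extChartAt_source (I := 𝓡 n) q
  have hdiff := differentiableAt_coordForm hα hq
  have hdiff' : DifferentiableAt ℝ (coordForm α a)
      (coordChange n a q (extChartAt (𝓡 n) q q)) := by
    rw [coordChange_extChartAt hq]
    exact differentiableAt_coordForm hα ha
  rw [extDerivForm, LinearMap.comp_apply, AlgHom.toLinearMap_apply,
    extDerivLocal_eq_coordExtDeriv hdiff,
    coordExtDeriv_of_isPullbackAt (contDiffAt_coordChange ha hq) (isPullbackAt_coordForm ha hq α)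
      hdiff hdiff', LinearMap.comp_apply, AlgHom.toLinearMap_apply,
    ← chartExt_eq_map_coordChange ha hq, coordChange_extChartAt hq]

theorem coordForm_interior (ha : q ∈ (extChartAt (𝓡 n) a).source) (X : RoughMVF n M)
    (α : RoughForm n M) :
    coordForm (interior X α) a =ᶠ[𝓝 (extChartAt (𝓡 n) a q)]
      fun z => interiorBilin n (coordForm α a z) (coordMVF X a z) := by
  refine (eventually_nhds_extChartAt_iff ha).2 ?_
  filter_upwards [extChartAt_source_mem_nhds' ha] with r hr
  refine LinearMap.ext fun x => ?_
  rw [interiorBilin_apply, coordMVF_extChartAt hr, ← chartExt_chartExtInv hr x, ← map_mul,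
    coordForm_extChartAt_chartExt hr, coordForm_extChartAt_chartExt hr]
  rfl

theorem isSmoothForm_interior (hX : IsSmoothMVF X) (hα : IsSmoothForm α) :
    IsSmoothForm (interior X α) := fun a q ha =>
  (contDiffAt_bilin (interiorBilin n) (hα a q ha) (contDiffAt_coordMVF hX ha)).congr_of_eventuallyEq
    (coordForm_interior ha X α)

end Charts

/-! ## Gluing by a partition of unity -/

section Gluing

variable {n : ℕ} {M : Type*} [TopologicalSpace M] [ChartedSpace (Model n) M]
  {ρ : SmoothPartitionOfUnity M (𝓡 n) M Set.univ} {p : M} {c c' : M → Ext n}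

/-- The value at `p` of the section of `∧^• TM` glued from its values `c a` in the charts around
the points `a`. -/
def glueAt (ρ : SmoothPartitionOfUnity M (𝓡 n) M Set.univ) (p : M) :
    (M → Ext n) →ₗ[ℝ] ExtFibre n p :=
  ∑ a ∈ ρ.finsupport p, ρ a p • (chartExtInv a p).toLinearMap ∘ₗ LinearMap.proj a

theorem glueAt_apply (p : M) (c : M → Ext n) :
    glueAt ρ p c = ∑ a ∈ ρ.finsupport p, ρ a p • chartExtInv a p (c a) := by
  simp only [glueAt, LinearMap.sum_apply, LinearMap.smul_apply, LinearMap.comp_apply,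
    LinearMap.proj_apply, AlgHom.toLinearMap_apply]

section Subordinate

variable (hρ : ρ.IsSubordinate fun a => (chartAt (Model n) a).source)
include hρ

theorem mem_source_of_mem_finsupport {a : M} (ha : a ∈ ρ.finsupport p) :
    p ∈ (extChartAt (𝓡 n) a).source := by
  rw [extChartAt_source]
  exact hρ a (subset_tsupport _ ((ρ.mem_finsupport p).1 ha))

theorem glueAt_mem {j : ℕ} (h : ∀ a, p ∈ (extChartAt (𝓡 n) a).source → c a ∈ ⋀[ℝ]^j (Model n)) :
    glueAt ρ p c ∈ ⋀[ℝ]^j (TangentSpace (𝓡 n) p) := by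
  rw [glueAt_apply]
  exact Submodule.sum_mem _ fun a ha => Submodule.smul_mem _ _
    (map_mem_exteriorPower _ (h a (mem_source_of_mem_finsupport hρ ha)))

theorem glueAt_congr (h : ∀ a, p ∈ (extChartAt (𝓡 n) a).source → c a = c' a) :
    glueAt ρ p c = glueAt ρ p c' := by
  rw [glueAt_apply, glueAt_apply]
  exact Finset.sum_congr rfl fun a ha => by rw [h a (mem_source_of_mem_finsupport hρ ha)]

theorem apply_glueAt {α : RoughForm n M} {r : ℝ}
    (h : ∀ a, p ∈ (extChartAt (𝓡 n) a).source →
      coordForm α a (extChartAt (𝓡 n) a p) (c a) = r) : α p (glueAt ρ p c) = r := by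
  have hterm : ∀ a ∈ ρ.finsupport p, α p (ρ a p • chartExtInv a p (c a)) = ρ a p * r := by
    intro a ha
    have hp := mem_source_of_mem_finsupport hρ ha
    rw [map_smul, smul_eq_mul, ← h a hp, coordForm_extChartAt hp]
    rfl
  rw [glueAt_apply, map_sum, Finset.sum_congr rfl hterm, ← Finset.sum_mul,
    ρ.sum_finsupport p (Set.mem_univ p), one_mul]

theorem glueAt_chartExt [IsManifold (𝓡 n) ∞ M] (v : ExtFibre n p) :
    glueAt ρ p (fun a => chartExt a p v) = v := by
  have hterm : ∀ a ∈ ρ.finsupport p, ρ a p • chartExtInv a p (chartExt a p v) = ρ a p • v :=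
    fun a ha => by rw [chartExtInv_chartExt (mem_source_of_mem_finsupport hρ ha)]
  rw [glueAt_apply, Finset.sum_congr rfl hterm, ← Finset.sum_smul,
    ρ.sum_finsupport p (Set.mem_univ p), one_smul]

end Subordinate

variable [IsManifold (𝓡 n) ∞ M]

theorem contDiffAt_comp_extChartAt_symm {f : M → ℝ} (hf : ContMDiff (𝓡 n) 𝓘(ℝ, ℝ) ∞ f) {a q : M}
    (ha : q ∈ (extChartAt (𝓡 n) a).source) :
    ContDiffAt ℝ ∞ (fun z => f ((extChartAt (𝓡 n) a).symm z)) (extChartAt (𝓡 n) a q) :=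
  (hf.comp_contMDiffOn (contMDiffOn_extChartAt_symm a)).contDiffOn.contDiffAt
    ((isOpen_extChartAt_target a).mem_nhds ((extChartAt (𝓡 n) a).map_source ha))

theorem isSmoothMVF_smul_chartExtInv {f : M → ℝ} (hf : ContMDiff (𝓡 n) 𝓘(ℝ, ℝ) ∞ f) {a : M}
    (hsupp : tsupport f ⊆ (extChartAt (𝓡 n) a).source) {F : Model n → Ext n}
    (hF : ∀ q ∈ (extChartAt (𝓡 n) a).source, ContDiffAt ℝ ∞ F (extChartAt (𝓡 n) a q)) :
    IsSmoothMVF (n := n) fun p => f p • chartExtInv a p (F (extChartAt (𝓡 n) a p)) := by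
  refine isSmoothMVF_of_contDiffAt fun q => ?_
  by_cases hq : q ∈ tsupport f
  · have ha := hsupp hq
    refine ⟨a, ha, ((contDiffAt_comp_extChartAt_symm hf ha).smul
      (hF q ha)).congr_of_eventuallyEq ((eventually_nhds_extChartAt_iff ha).2 ?_)⟩
    filter_upwards [extChartAt_source_mem_nhds' ha] with r hr
    rw [coordMVF_extChartAt hr, map_smul, chartExt_chartExtInv hr, Pi.smul_apply',
      (extChartAt (𝓡 n) a).left_inv hr]
  · have hqs := mem_extChartAt_source (I := 𝓡 n) q
    refine ⟨q, hqs, (contDiffAt_const (c := (0 : Ext n))).congr_of_eventuallyEq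
      ((eventually_nhds_extChartAt_iff hqs).2 ?_)⟩
    filter_upwards [extChartAt_source_mem_nhds' hqs,
      (isClosed_tsupport f).isOpen_compl.mem_nhds hq] with r hr hrf
    rw [coordMVF_extChartAt hr, image_eq_zero_of_notMem_tsupport hrf, zero_smul, map_zero]

theorem isSmoothMVF_glueAt (hρ : ρ.IsSubordinate fun a => (chartAt (Model n) a).source)
    {F : M → Model n → Ext n}
    (hF : ∀ a, ∀ q ∈ (extChartAt (𝓡 n) a).source, ContDiffAt ℝ ∞ (F a) (extChartAt (𝓡 n) a q)) :
    IsSmoothMVF (n := n) fun p => glueAt ρ p fun a => F a (extChartAt (𝓡 n) a p) := by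
  refine isSmoothMVF_of_contDiffAt fun q => ?_
  have hq := mem_extChartAt_source (I := 𝓡 n) q
  have hcut : ∀ a, IsSmoothMVF (n := n) fun p =>
      ρ a p • chartExtInv a p (F a (extChartAt (𝓡 n) a p)) := fun a =>
    isSmoothMVF_smul_chartExtInv (ρ a).contMDiff (by rw [extChartAt_source]; exact hρ a) (hF a)
  have hsum := ContDiffAt.sum (s := ρ.fintsupport q) fun a _ => contDiffAt_coordMVF (hcut a) hq
  refine ⟨q, hq, hsum.congr_of_eventuallyEq ((eventually_nhds_extChartAt_iff hq).2 ?_)⟩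
  filter_upwards [extChartAt_source_mem_nhds' hq, ρ.eventually_finsupport_subset q] with r hr hsub
  simp only [coordMVF_extChartAt hr]
  rw [← map_sum, glueAt_apply]
  congr 1
  refine Finset.sum_subset hsub fun a _ ha => ?_
  rw [ρ.mem_finsupport, Function.notMem_support] at ha
  rw [ha, zero_smul]

theorem exists_mvf_eventually_eq_chartExtInv [T2Space M] (q : M) {k : ℕ} {x : Ext n}
    (hx : x ∈ ⋀[ℝ]^k (Model n)) :
    ∃ X : MVF n M, X.HasDegree k ∧ ∀ᶠ r in 𝓝 q, X.1 r = chartExtInv q r x := by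
  obtain ⟨f, -⟩ := (SmoothBumpFunction.nhds_basis_tsupport (I := 𝓡 n) q).ex_mem
  refine ⟨⟨fun p => f p • chartExtInv q p x, isSmoothMVF_smul_chartExtInv (F := fun _ => x)
    f.contMDiff f.tsupport_subset_extChartAt_source fun _ _ => contDiffAt_const⟩,
    fun p => Submodule.smul_mem _ _ (map_mem_exteriorPower _ hx), ?_⟩
  filter_upwards [f.eventuallyEq_one] with r hr
  rw [hr, Pi.one_apply, one_smul]

end Gluing

section Components

variable {n : ℕ} {M : Type*} [TopologicalSpace M] [ChartedSpace (Model n) M] (η : AssocForm n M)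

theorem component_apply_of_mem (t : ℕ) {s : ℕ} {p : M} {x : ExtFibre n p}
    (hx : x ∈ ⋀[ℝ]^s (TangentSpace (𝓡 n) p)) :
    η.component t p x = if s = t then η.form p x 1 else 0 := by
  refine (congrArg (fun z => η.form p z 1) (degreeProj_of_mem hx t)).trans ?_
  split_ifs
  · rfl
  · rw [map_zero, LinearMap.zero_apply]

theorem coordForm_component_mem (t : ℕ) (a : M) (z : Model n) :
    coordForm (η.component t) a z ∈ homogeneousCovectors ℝ (Model n) t :=
  mem_homogeneousCovectors.2 fun _ hs _ hx =>
    (component_apply_of_mem η t (map_mem_exteriorPower _ hx)).trans (if_neg hs)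

theorem component_eq_zero_of_lt {t : ℕ} (ht : n < t) : η.component t = 0 := by
  refine funext fun p => LinearMap.ext fun x => ?_
  have hx : degreeProj t x = 0 :=
    eq_zero_of_mem_exteriorPower_of_card_lt (V := TangentSpace (𝓡 n) p) (stdBasis n)
      (by rwa [Fintype.card_fin]) (Subtype.prop _)
  exact (congrArg (fun z => η.form p z 1) hx).trans (LinearMap.map_zero₂ _ _)

theorem isSmoothForm_component [IsManifold (𝓡 n) ∞ M] [T2Space M] (t : ℕ) :
    IsSmoothForm (η.component t) := by
  intro a q ha
  have hq := mem_extChartAt_source (I := 𝓡 n) q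
  refine contDiffAt_coordForm_of_contDiffAt hq ha (contDiffAt_extDual_iff.2 fun S => ?_)
  have hS : extBasis n S ∈ ⋀[ℝ]^S.card (Model n) := exteriorAlgebra_basis_mem (stdBasis n) S
  by_cases hSt : S.card = t
  · obtain ⟨X, hX, hXq⟩ := exists_mvf_eventually_eq_chartExtInv q hS
    have hone : (1 : MVF n M).HasDegree 0 := fun p => SetLike.one_mem_graded _
    refine (contDiffAt_comp_extChartAt_symm (η.smooth hX hone) hq).congr_of_eventuallyEq
      ((eventually_nhds_extChartAt_iff hq).2 ?_)
    filter_upwards [hXq, extChartAt_source_mem_nhds' hq] with r hr hrq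
    rw [(extChartAt (𝓡 n) q).left_inv hrq, hr, coordForm_extChartAt hrq]
    exact (component_apply_of_mem η t (map_mem_exteriorPower _ hS)).trans (if_pos hSt)
  · refine (contDiffAt_const (c := (0 : ℝ))).congr_of_eventuallyEq (.of_forall fun z => ?_)
    exact mem_homogeneousCovectors.1 (coordForm_component_mem η t q z) _ hSt _ hS

end Components

/-! ## The glued connection -/

section GluedConnection

variable {n : ℕ} {M : Type*} [TopologicalSpace M] [ChartedSpace (Model n) M]

theorem MVF.HasDegree.coordMVF_mem {k : ℕ} {X : MVF n M} (hX : X.HasDegree k) (a : M)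
    (z : Model n) : coordMVF X.1 a z ∈ ⋀[ℝ]^k (Model n) :=
  map_mem_exteriorPower _ (hX _)

theorem coordMVF_add (X Y : RoughMVF n M) (a : M) :
    coordMVF (X + Y) a = fun z => coordMVF X a z + coordMVF Y a z :=
  funext fun _ => map_add _ _ _

section ActiveDegrees

open Classical in
/-- The degrees `t > 1` of the nonzero components of `η`: a connection is parallel for `η` once
these components are parallel. -/
def activeDegrees (η : AssocForm n M) : Finset ℕ :=
  (Finset.range (n + 1)).filter fun t => 1 < t ∧ η.component t ≠ 0

variable {η : AssocForm n M} {t : ℕ}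

theorem mem_activeDegrees : t ∈ activeDegrees η ↔ 1 < t ∧ η.component t ≠ 0 := by
  simp only [activeDegrees, Finset.mem_filter, Finset.mem_range, and_iff_right_iff_imp]
  rintro ⟨-, h⟩
  contrapose! h
  exact component_eq_zero_of_lt η h

theorem one_notMem_activeDegrees : 1 ∉ activeDegrees η := fun h =>
  lt_irrefl 1 (mem_activeDegrees.1 h).1

theorem component_eq_zero_of_notMem_activeDegrees (hη : η.component 1 = 0) (ht : 0 < t)
    (h : t ∉ activeDegrees η) : η.component t = 0 := by
  rcases (Nat.succ_le_of_lt ht).eq_or_lt with rfl | ht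
  · exact hη
  · by_contra h0
    exact h (mem_activeDegrees.2 ⟨ht, h0⟩)

theorem AssocForm.IsNonvanishing.component_ne_zero (hη : η.IsNonvanishing)
    (ht : t ∈ activeDegrees η) (p : M) : η.component t p ≠ 0 :=
  hη.2 t (mem_activeDegrees.1 ht).1 (mem_activeDegrees.1 ht).2 p

end ActiveDegrees

/-- The covariant derivative `∇_X Y` at `p` of the connection in the chart around `a` for which
the components of `η` are parallel. -/
def localCov (η : AssocForm n M) (X Y : MVF n M) (p a : M) : Ext n :=
  chartCov (activeDegrees η) (fun t => coordForm (η.component t) a) (coordMVF Y.1 a)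
    (extChartAt (𝓡 n) a p) (coordMVF X.1 a (extChartAt (𝓡 n) a p))

section LocalCovRight

variable {η : AssocForm n M} {X Y Y' : MVF n M} {p a : M}

theorem localCov_one_right : localCov η X 1 p a = 0 := by
  have hone : coordMVF (1 : MVF n M).1 a = fun _ => 1 := funext fun _ => map_one _
  rw [localCov, hone, chartCov_one, LinearMap.zero_apply]

theorem localCov_add_right (ha : p ∈ (extChartAt (𝓡 n) a).source) :
    localCov η X (Y + Y') p a = localCov η X Y p a + localCov η X Y' p a := by
  have hY : coordMVF (Y + Y').1 a = _ := coordMVF_add Y.1 Y'.1 a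
  rw [localCov, hY, chartCov_add (differentiableAt_coordMVF Y.2 ha)
    (differentiableAt_coordMVF Y'.2 ha)]
  rfl

end LocalCovRight

variable [IsManifold (𝓡 n) ∞ M]

section Functions

variable (f : C^∞⟮𝓡 n, M; ℝ⟯) (a : M)

theorem ofFun_mul_apply (X : MVF n M) (p : M) : (ofFun f * X).1 p = f p • X.1 p :=
  (Algebra.smul_def (f p) (X.1 p)).symm

theorem coordMVF_ofFun : coordMVF (ofFun f).1 a =
    fun z => algebraMap ℝ (Ext n) (f ((extChartAt (𝓡 n) a).symm z)) :=
  funext fun _ => AlgHom.commutes _ _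

theorem coordMVF_ofFun_mul (X : MVF n M) : coordMVF (ofFun f * X).1 a =
    fun z => f ((extChartAt (𝓡 n) a).symm z) • coordMVF X.1 a z := by
  funext z
  rw [coordMVF, ofFun_mul_apply, map_smul, coordMVF]

end Functions

section LocalCov

variable {η : AssocForm n M} {f : C^∞⟮𝓡 n, M; ℝ⟯} {X X' Y : MVF n M} {p a : M} {k l : ℕ}

theorem localCov_ofFun_left : localCov η (ofFun f) Y p a = 0 := by
  rw [localCov, coordMVF_ofFun]
  exact chartCov_apply_of_mem_zero (SetLike.algebraMap_mem_graded _ _)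

variable (ha : p ∈ (extChartAt (𝓡 n) a).source)
include ha

theorem localCov_linear_left :
    localCov η (ofFun f * X + X') Y p a = f p • localCov η X Y p a + localCov η X' Y p a := by
  have hX : coordMVF (ofFun f * X + X').1 a (extChartAt (𝓡 n) a p) =
      f p • coordMVF X.1 a (extChartAt (𝓡 n) a p) + coordMVF X'.1 a (extChartAt (𝓡 n) a p) := by
    refine (congrFun (coordMVF_add (ofFun f * X).1 X'.1 a) _).trans ?_
    simp only [coordMVF_ofFun_mul, (extChartAt (𝓡 n) a).left_inv ha]
  rw [localCov, hX, map_add, map_smul]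
  rfl

theorem localCov_leibniz :
    localCov η X (ofFun f * Y) p a =
      chartExt a p (schouten X.1 (ofFun f).1 p * Y.1 p) + f p • localCov η X Y p a := by
  have hf := (contDiffAt_comp_extChartAt_symm f.contMDiff ha).differentiableAt (by simp)
  rw [localCov, coordMVF_ofFun_mul, chartCov_smul hf (differentiableAt_coordMVF Y.2 ha),
    ← coordMVF_ofFun, ← chartExt_schouten X.2 (ofFun f).2 ha, coordMVF_extChartAt ha Y.1,
    ← map_mul, (extChartAt (𝓡 n) a).left_inv ha]
  rfl

theorem localCov_torsion (hX : X.HasDegree k) (hY : Y.HasDegree l) (hXY : X * Y = 0) :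
    localCov η X Y p a - (-1 : ℝ) ^ (((k : ℤ) - 1) * ((l : ℤ) - 1)) • localCov η Y X p a =
      chartExt a p (schouten X.1 Y.1 p) := by
  rw [chartExt_schouten X.2 Y.2 ha]
  refine chartCov_torsion (differentiableAt_coordMVF X.2 ha) (differentiableAt_coordMVF Y.2 ha)
    (.of_forall (hX.coordMVF_mem a)) (hY.coordMVF_mem a _) ?_
  rw [coordMVF_extChartAt ha, coordMVF_extChartAt ha, ← map_mul]
  exact (congrArg (fun Z : MVF n M => chartExt a p (Z.1 p)) hXY).trans (map_zero _)

variable [T2Space M]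

theorem differentiableAt_coordForm_component (η : AssocForm n M) (t : ℕ) :
    DifferentiableAt ℝ (coordForm (η.component t) a) (extChartAt (𝓡 n) a p) :=
  differentiableAt_coordForm (isSmoothForm_component η t) ha

theorem localCov_mem {j : ℕ} (hX : X.HasDegree k) (hY : Y.HasDegree l) (hj : j + 1 = k + l) :
    localCov η X Y p a ∈ ⋀[ℝ]^j (Model n) :=
  chartCov_mem (fun t _ => differentiableAt_coordForm_component ha η t)
    (fun t _ => .of_forall (coordForm_component_mem η t a)) (differentiableAt_coordMVF Y.2 ha)
    (.of_forall (hY.coordMVF_mem a)) (hX.coordMVF_mem a _) hj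

theorem localCov_torsion_one (hX : X.HasDegree 1) (hY : Y.HasDegree 1) :
    localCov η X Y p a - localCov η Y X p a = chartExt a p (schouten X.1 Y.1 p) := by
  rw [chartExt_schouten X.2 Y.2 ha]
  have h := chartCov_torsion_one (one_notMem_activeDegrees (η := η))
    (fun t _ => differentiableAt_coordForm_component ha η t)
    (fun t _ => .of_forall (coordForm_component_mem η t a)) (differentiableAt_coordMVF X.2 ha)
    (differentiableAt_coordMVF Y.2 ha) (.of_forall (hX.coordMVF_mem a)) (hY.coordMVF_mem a _)
  rwa [Nat.cast_one, sub_self, mul_zero, zpow_zero, one_smul] at h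

end LocalCov

section Glued

variable [T2Space M] {ρ : SmoothPartitionOfUnity M (𝓡 n) M Set.univ}
  (hρ : ρ.IsSubordinate fun a => (chartAt (Model n) a).source)
  {η : AssocForm n M} (hη : η.IsNonvanishing)

include hρ hη in
theorem isSmoothMVF_glueAt_localCov (X Y : MVF n M) :
    IsSmoothMVF (n := n) fun p => glueAt ρ p (localCov η X Y p) :=
  isSmoothMVF_glueAt hρ (F := fun a z => chartCov (activeDegrees η)
      (fun t => coordForm (η.component t) a) (coordMVF Y.1 a) z (coordMVF X.1 a z))
    fun _ q hq => contDiffAt_chartCov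
      (fun t _ => isSmoothForm_component η t _ q hq)
      (fun _ ht => coordForm_extChartAt_ne_zero hq (hη.component_ne_zero ht q))
      (contDiffAt_coordMVF X.2 hq) (contDiffAt_coordMVF Y.2 hq)

/-- The covariant derivative glued from those in the charts by the partition of unity `ρ`. -/
def gluedCov (X Y : MVF n M) : MVF n M :=
  ⟨fun p => glueAt ρ p (localCov η X Y p), isSmoothMVF_glueAt_localCov hρ hη X Y⟩

theorem gluedCov_apply (X Y : MVF n M) (p : M) :
    (gluedCov hρ hη X Y).1 p = glueAt ρ p (localCov η X Y p) := rfl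

theorem gluedCov_ofFun_left (f : C^∞⟮𝓡 n, M; ℝ⟯) (Y : MVF n M) :
    gluedCov hρ hη (ofFun f) Y = 0 := by
  refine Subtype.ext (funext fun p => ?_)
  rw [gluedCov_apply, glueAt_congr hρ (c' := 0) fun _ _ => localCov_ofFun_left, map_zero]
  rfl

theorem gluedCov_one_right (X : MVF n M) : gluedCov hρ hη X 1 = 0 := by
  refine Subtype.ext (funext fun p => ?_)
  rw [gluedCov_apply, glueAt_congr hρ (c' := 0) fun _ _ => localCov_one_right, map_zero]
  rfl

theorem gluedCov_linear_left (f : C^∞⟮𝓡 n, M; ℝ⟯) (X X' Y : MVF n M) :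
    gluedCov hρ hη (ofFun f * X + X') Y =
      ofFun f * gluedCov hρ hη X Y + gluedCov hρ hη X' Y := by
  refine Subtype.ext (funext fun p => ?_)
  rw [gluedCov_apply, glueAt_congr hρ (c' := f p • localCov η X Y p + localCov η X' Y p)
    fun _ => localCov_linear_left, map_add, map_smul, ← gluedCov_apply hρ hη,
    ← gluedCov_apply hρ hη, ← ofFun_mul_apply]
  rfl

theorem gluedCov_add_right (X Y Y' : MVF n M) :
    gluedCov hρ hη X (Y + Y') = gluedCov hρ hη X Y + gluedCov hρ hη X Y' := by
  refine Subtype.ext (funext fun p => ?_)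
  rw [gluedCov_apply, glueAt_congr hρ (c' := localCov η X Y p + localCov η X Y' p)
    fun _ => localCov_add_right, map_add]
  rfl

theorem gluedCov_leibniz (f : C^∞⟮𝓡 n, M; ℝ⟯) (X Y : MVF n M) :
    (gluedCov hρ hη X (ofFun f * Y)).1 =
      schouten X.1 (ofFun f).1 * Y.1 + (ofFun f * gluedCov hρ hη X Y).1 := by
  funext p
  rw [gluedCov_apply, glueAt_congr hρ (c' := (fun a => chartExt a p
      (schouten X.1 (ofFun f).1 p * Y.1 p)) + f p • localCov η X Y p)
    fun _ => localCov_leibniz, map_add, map_smul, glueAt_chartExt hρ, ← gluedCov_apply hρ hη,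
    ← ofFun_mul_apply]
  rfl

theorem gluedCov_ofFun_right (f : C^∞⟮𝓡 n, M; ℝ⟯) (X : MVF n M) :
    (gluedCov hρ hη X (ofFun f)).1 = schouten X.1 (ofFun f).1 := by
  have h := gluedCov_leibniz hρ hη f X 1
  rw [gluedCov_one_right, mul_zero, mul_one] at h
  exact h.trans ((add_zero _).trans (mul_one _))

/-- The higher connection glued from those in the charts by the partition of unity `ρ`. -/
def gluedConnection : HigherConnection n M where
  cov := gluedCov hρ hη
  hasDegree_cov hj hX hY _ := glueAt_mem hρ fun _ ha => localCov_mem ha hX hY hj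
  cov_linear_left := gluedCov_linear_left hρ hη
  cov_add_right := gluedCov_add_right hρ hη
  cov_ofFun_right f _ := gluedCov_ofFun_right hρ hη f _
  cov_leibniz f Y _ := gluedCov_leibniz hρ hη f _ Y
  cov_ofFun_left := gluedCov_ofFun_left hρ hη

theorem torsion_gluedConnection_eq_zero {k l : ℕ} {X Y : MVF n M}
    (h : ∀ p a : M, p ∈ (extChartAt (𝓡 n) a).source → localCov η X Y p a -
        (-1 : ℝ) ^ (((k : ℤ) - 1) * ((l : ℤ) - 1)) • localCov η Y X p a =
      chartExt a p (schouten X.1 Y.1 p)) :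
    (gluedConnection hρ hη).torsion k l X Y = 0 := by
  funext p
  change glueAt ρ p _ - (_ : ℝ) • glueAt ρ p _ - schouten X.1 Y.1 p = 0
  rw [sub_eq_zero, ← map_smul, ← map_sub, ← glueAt_chartExt hρ (schouten X.1 Y.1 p)]
  exact glueAt_congr hρ (h p)

theorem almostTorsionFree_gluedConnection : (gluedConnection hρ hη).AlmostTorsionFree := by
  refine ⟨fun X Y hX hY => torsion_gluedConnection_eq_zero hρ hη fun p a ha => ?_,
    fun k l X Y hX hY hXY => torsion_gluedConnection_eq_zero hρ hη fun p a ha =>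
      localCov_torsion ha hX hY hXY⟩
  rw [← localCov_torsion_one (η := η) ha hX hY]
  simp

end Glued

end GluedConnection

/-! ## Parallelism -/

section Parallelism

variable {n : ℕ} {M : Type*} [TopologicalSpace M] [ChartedSpace (Model n) M] {η : AssocForm n M}

theorem AssocForm.IsPlectic.isNonvanishing (hη : η.IsPlectic) : η.IsNonvanishing := by
  refine ⟨hη.1, fun t ht h0 p hp => h0 (component_eq_zero_of_lt η ?_)⟩
  have hzero : ∀ v : TangentSpace (𝓡 n) p, v = 0 := fun v =>
    ((hη.2 t ht h0).2 p v).1 (by rw [hp, LinearMap.zero_comp])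
  have hsub : Subsingleton (Model n) := ⟨fun v w => (hzero v).trans (hzero w).symm⟩
  have hn : n = 0 := by
    simpa using Module.finrank_zero_of_subsingleton (R := ℝ) (M := Model n)
  omega

theorem isSmoothForm_zero : IsSmoothForm (0 : RoughForm n M) := fun _ _ _ =>
  contDiffAt_const (c := (0 : Module.Dual ℝ (Ext n)))

theorem neg_one_zpow_mul_neg_pow_mul_zpow_mul {k l t : ℕ} (h : t + 1 = k + l) (r : ℝ) :
    (-1 : ℝ) ^ (((k : ℤ) - 1) * ((t : ℤ) - 1)) *
      -((-1) ^ k * ((-1) ^ (((k : ℤ) - 1) * ((l : ℤ) - 1)) * r)) = r := by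
  have ht : (t : ℤ) - 1 = k + l - 2 := by omega
  have hodd : Odd (((k : ℤ) - 1) * (t - 1) + (k + (k - 1) * (l - 1))) := by
    obtain ⟨r, hr⟩ := Int.even_mul_pred_self k
    exact ⟨r + (k - 1) * (l - 1), by rw [ht]; linear_combination hr⟩
  have hsign := hodd.neg_one_zpow (α := ℝ)
  rw [zpow_add₀ (by norm_num), zpow_add₀ (by norm_num), zpow_natCast] at hsign
  linear_combination -r * hsign

variable [IsManifold (𝓡 n) ∞ M]

theorem lieDerivForm_interior_one {α : RoughForm n M} (hα : IsSmoothForm α) (k : ℕ)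
    (X W : MVF n M) {a p : M} (ha : p ∈ (extChartAt (𝓡 n) a).source) :
    lieDerivForm k X.1 (interior W.1 α) p 1 =
      -((-1 : ℝ) ^ k * coordExtDeriv
        (fun z => interiorBilin n (coordForm α a z) (coordMVF W.1 a z))
        (extChartAt (𝓡 n) a p) (coordMVF X.1 a (extChartAt (𝓡 n) a p))) := by
  have hW := isSmoothForm_interior W.2 hα
  have hfunction : extDerivForm (interior X.1 (interior W.1 α)) p 1 = 0 := by
    rw [extDerivForm_apply (isSmoothForm_interior X.2 hW) ha, map_one, coordExtDeriv_apply]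
    exact Finset.sum_eq_zero fun i _ => by
      rw [contraction_eq_zero_of_mem_zero _ SetLike.GradedOne.one_mem, map_zero]
  have hd : interior X.1 (extDerivForm (interior W.1 α)) p 1 =
      extDerivForm (interior W.1 α) p (X.1 p) :=
    congrArg (extDerivForm (interior W.1 α) p) (mul_one _)
  rw [lieDerivForm, LinearMap.sub_apply, LinearMap.smul_apply, smul_eq_mul, hfunction, hd,
    extDerivForm_apply hW ha, zero_sub, coordMVF_extChartAt ha, coordExtDeriv, coordExtDeriv,
    (coordForm_interior ha W.1 α).fderiv_eq]

section Glued

variable [T2Space M] {ρ : SmoothPartitionOfUnity M (𝓡 n) M Set.univ}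
  (hρ : ρ.IsSubordinate fun a => (chartAt (Model n) a).source) (hη : η.IsNonvanishing)

theorem component_gluedCov_eq_lieDerivForm {k l t : ℕ} {X W : MVF n M} (hX : X.HasDegree k)
    (hW : W.HasDegree l) (hl : 0 < l) (h : t + 1 = k + l) (ht : t ∈ activeDegrees η) (p : M) :
    η.component t p ((gluedCov hρ hη X W).1 p) =
      (-1 : ℝ) ^ (((k : ℤ) - 1) * ((t : ℤ) - 1)) *
        lieDerivForm k X.1 (interior W.1 (η.component t)) p 1 := by
  refine apply_glueAt hρ fun a ha => ?_
  have hd := coordExtDeriv_interiorBilin_eq_apply_chartCov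
    (w := fun t => coordForm (η.component t) a) ht
    (fun t _ => coordForm_component_mem η t a _) (differentiableAt_coordForm_component ha η t)
    (coordForm_extChartAt_ne_zero ha (hη.component_ne_zero ht p)) (differentiableAt_coordMVF W.2 ha)
    (hX.coordMVF_mem a (extChartAt (𝓡 n) a p)) hl (.of_forall (hW.coordMVF_mem a))
  rw [lieDerivForm_interior_one (isSmoothForm_component η t) k X W ha, hd]
  exact (neg_one_zpow_mul_neg_pow_mul_zpow_mul h _).symm

theorem isParallel_gluedConnection : η.IsParallel (gluedConnection hρ hη) := by
  intro k l m t X Y Z hX hY hZ hk hlm ht p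
  have hYZ : (Y * Z).HasDegree (l + m) := fun q => SetLike.mul_mem_graded (hY q) (hZ q)
  rw [HigherConnection.covForm, sub_eq_zero]
  by_cases hmem : t ∈ activeDegrees η
  · exact (component_gluedCov_eq_lieDerivForm hρ hη hX hYZ hlm (by omega) hmem p).symm
  · rw [component_eq_zero_of_notMem_activeDegrees hη.1 (by omega) hmem,
      lieDerivForm_interior_one isSmoothForm_zero k X (Y * Z) (mem_extChartAt_source p)]
    have hinterior : (fun z => interiorBilin n (coordForm (0 : RoughForm n M) p z)
        (coordMVF (Y * Z).1 p z)) = fun _ => 0 := rfl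
    rw [hinterior]
    simp [coordExtDeriv]

end Glued

theorem exists_almostTorsionFree_isParallel [T2Space M] [SecondCountableTopology M]
    (hη : η.IsNonvanishing) :
    ∃ D : HigherConnection n M, D.AlmostTorsionFree ∧ η.IsParallel D := by
  have : LocallyCompactSpace M := ChartedSpace.locallyCompactSpace (Model n) M
  obtain ⟨ρ, hρ⟩ := SmoothPartitionOfUnity.exists_isSubordinate_chartAt_source (𝓡 n) M
  exact ⟨gluedConnection hρ hη, almostTorsionFree_gluedConnection hρ hη,
    isParallel_gluedConnection hρ hη⟩

end Parallelism

end HigherConn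

end

open HigherConn in
theorem mainTheorem12 (n : ℕ) (M : Type*) [TopologicalSpace M] [T2Space M]
    [SecondCountableTopology M] [ChartedSpace (EuclideanSpace ℝ (Fin n)) M]
    [IsManifold (𝓡 n) ∞ M] :
    (∀ η : AssocForm n M, η.IsNonvanishing →
      ∃ D : HigherConnection n M, D.AlmostTorsionFree ∧ η.IsParallel D) ∧
    (∀ η : AssocForm n M, η.IsPlectic →
      ∃ D : HigherConnection n M, D.AlmostTorsionFree ∧ η.IsParallel D) :=
  ⟨fun _ hη => exists_almostTorsionFree_isParallel hη, fun _ hη =>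
    exists_almostTorsionFree_isParallel hη.isNonvanishing⟩
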